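/- **Setting.** A crowd consists of $n$ workers. Worker $i$ has an error rate $\eta_i\in[0,1/2]$. For every data point $x$ from a set $X$, worker $i$ has a label $w_i(x)\in\{0,1\}$, the same whenever it is asked for, which differs from the true label $c(x)$ with probability $\eta_i$; the labels are mutually independent over all workers and data points. For a non-empty set $S$ of workers let $\bar\eta_S=\frac1{|S|}\sum_{i\in S}\eta_i$, let $\bar\eta_W$ be the average over all $n$ workers, and assume $\bar\eta_W<1/2$. Let $\bar\eta^*_{K,W}$ be the minimum of $\bar\eta_S$ over all $S$ with $|S|=K$. A set $S$ of $K$ workers is $\Delta$-optimal if $\bar\eta_S\le\bar\eta^*_{K,W}+\Delta$. A task is one data point given to one worker to be labeled. **OptMAI$(n,K,q)$** is the following bandit algorithm with the workers as arms. Let $\beta=\frac34e^{0.2}$, let all arms be remaining and no arm accepted, and run rounds $r=0,1,\dots$ as long as fewer than $K$ arms are accepted and some arm remains. In round $r$, with $S$ the set of remaining and $T$ the set of accepted arms, pull each arm of $S$ afresh $\lfloor\beta^r(1-\beta)q/|S|\rfloor$ times and let $\hat\theta_i$ be the mean reward of arm $i$ in this round. If $|S|>4K$, discard the $\lceil|S|/4\rceil$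 arms of $S$ with the smallest $\hat\theta_i$. If $|S|\le4K$, let $K'=K-|T|$, let $\hat\theta_{(k)}$ be the $k$-th largest of the $\hat\theta_i$, $i\in S$ (and $0$ for $k>|S|$), and $\hat g_i=\max(\hat\theta_i-\hat\theta_{(K'+1)},\hat\theta_{(K')}-\hat\theta_i)$; then, as long as fewer than $K$ arms are accepted and more than $\frac34|S|$ of the arms of $S$ are left, remove from those left the arm $a$ with the largest $\hat g_a$, and accept it if and only if $\hat\theta_a\ge\hat\theta_{(K')}$. Ties are broken in favour of the arm with the smaller index. The output is the set of accepted arms. **Voting phase.** Given $s$ distinct data points $y_1,\dots,y_s$, each $y_j$ is labeled by the majority vote of a panel of $m$ distinct workers, chosen uniformly at random and independently of the labels. OptMAI is then run with these voted labels in place of the true ones: the $j$-th pull of arm $i$ has reward $1$ if $w_i(y_j)$ agrees with the voted label of $y_j$, and $0$ otherwise. **Statement.** There are absolute constants $C_q,C_s,C_m>0$ such that, for every fixed $\delta_0<1$, there are $C>0$ and $k\in\mathbb N$ depending only on $\delta_0$ with the following property. Let $1\le K\le n/2$, $0<\Delta\le1/2$, $0<\delta\le\delta_0$, and put $$q=\Big\lceil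 C_q\frac n{\Delta^2}\Big(1+\frac{\log(1/\delta)}K\Big)\Big\rceil,\qquad s=\Big\lceil C_s\frac q{n^{0.3}}\Big\rceil,\qquad m=\Big\lceil C_m\frac{\log(s/\delta)}{(1-2\bar\eta_W)^2}\Big\rceil .$$ Assume that the crowd is large enough for the vote, i.e. $m\le n$. Then: 1. the total number of tasks given to workers in the voting phase is at most $C\,f\,\log^k(2+f)$, that is, it is $$\tilde{\mathcal O}(f),\qquad f=\frac{n^{0.7}\log(1/\delta)\Big(1+\frac{\log(1/\delta)}K\Big)}{\Delta^2(1-2\bar\eta_W)^2};$$ 2. OptMAI$(n,K,q)$ never pulls an arm more than $s$ times, so that the $s$ voted points suffice to run it; 3. with probability at least $1-\delta$, all $s$ voted labels are the true labels and, at the same time, OptMAI$(n,K,q)$, run with the voted labels, outputs a $\Delta$-optimal set of $K$ workers. -/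

import Mathlib

open MeasureTheory ProbabilityTheory

/-! ### Error rates of sets of workers -/

/-- The average error rate of the workers in `S`. -/
noncomputable def avgError {n : ℕ} (η : Fin n → ℝ) (S : Finset (Fin n)) : ℝ :=
  (∑ i ∈ S, η i) / (S.card : ℝ)

/-- The average error rate of the best `K` workers: the minimum (over a finite set of values) of the
average error rate over all sets of exactly `K` workers. -/
noncomputable def bestAvgError {n : ℕ} (η : Fin n → ℝ) (K : ℕ) : ℝ :=
  sInf {x : ℝ | ∃ S : Finset (Fin n), S.card = K ∧ x = avgError η S}

/-- `S` is a `Δ`-optimal set of `K` workers. -/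
def IsDeltaOptimal {n : ℕ} (η : Fin n → ℝ) (K : ℕ) (Δ : ℝ) (S : Finset (Fin n)) : Prop :=
  S.card = K ∧ avgError η S ≤ bestAvgError η K + Δ

/-! ### The bandit algorithm `OptMAI(n, K, q)`

An arm is an element of `Fin n`. A table `R : Fin n → ℕ → ℝ` of rewards is fixed: `R i j` is the
reward of the `j`-th pull of arm `i` (pulls are numbered from `0`). -/

/-- The empirical mean of arm `i` over its pulls number `a, …, a + t - 1`. -/
noncomputable def empMean {n : ℕ} (R : Fin n → ℕ → ℝ) (a t : ℕ) (i : Fin n) : ℝ :=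
  (∑ j ∈ Finset.Ico a (a + t), R i j) / (t : ℝ)

/-- The number of arms of `S` that are ranked above `i` when the arms are sorted by decreasing value
of `θ`, ties being broken in favour of the smaller index. -/
noncomputable def armRank {n : ℕ} (θ : Fin n → ℝ) (S : Finset (Fin n)) (i : Fin n) : ℕ := by
  classical
  exact (S.filter (fun j => θ i < θ j ∨ (θ i = θ j ∧ j < i))).card

/-- Quartile elimination: the lowest quarter (`⌈|S| / 4⌉` arms) of `S` with respect to the empirical
means `θ` is removed; the best `⌊3 |S| / 4⌋` arms stay. -/
noncomputable def quartileElim {n : ℕ} (θ : Fin n → ℝ) (S : Finset (Fin n)) : Finset (Fin n) := by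
  classical
  exact S.filter (fun i => armRank θ S i < 3 * S.card / 4)

/-- The `k`-th largest (`k ≥ 1`, counted with multiplicity) of the values of `θ` on `S`. It is `0`,
a lower bound of all rewards, if `S` has fewer than `k` elements. -/
noncomputable def kthLargest {n : ℕ} (θ : Fin n → ℝ) (S : Finset (Fin n)) (k : ℕ) : ℝ :=
  ((S.val.map θ).sort (fun x y => y ≤ x)).getD (k - 1) 0

/-- The empirical gap of arm `i`, when `k` arms of `S` are still to be selected: its distance to the
`(k+1)`-st largest empirical mean if it is among the best `k` arms, and to the `k`-th largest one
otherwise. -/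
noncomputable def empGap {n : ℕ} (θ : Fin n → ℝ) (S : Finset (Fin n)) (k : ℕ) (i : Fin n) : ℝ :=
  max (θ i - kthLargest θ S (k + 1)) (kthLargest θ S k - θ i)

/-- The first element of `S` at which `g` is maximal on `S`. -/
noncomputable def firstArgmax {n : ℕ} (g : Fin n → ℝ) (S : Finset (Fin n)) (hS : S.Nonempty) :
    Fin n := by
  classical
  exact (S.filter (fun i => ∀ j ∈ S, g j ≤ g i)).min' (by
    obtain ⟨i, hi, h⟩ := S.exists_max_image g hS
    exact ⟨i, Finset.mem_filter.mpr ⟨hi, h⟩⟩)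

/-- One pass of the inner loop of accept-reject. The state is the pair of the set of remaining arms
and the set of accepted arms. While fewer than `K` arms are accepted and more than `3 s / 4` arms
remain, the arm with the largest gap `g` is removed; it is accepted if its empirical mean is at
least the threshold `v`, and rejected otherwise. -/
noncomputable def arPass {n : ℕ} (K s : ℕ) (θ g : Fin n → ℝ) (v : ℝ)
    (p : Finset (Fin n) × Finset (Fin n)) : Finset (Fin n) × Finset (Fin n) := by
  classical
  exact
    if h : p.2.card < K ∧ 3 * s < 4 * p.1.card then
      let a := firstArgmax g p.1 (Finset.card_pos.mp (by omega))
      (p.1.erase a, if v ≤ θ a then insert a p.2 else p.2)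
    else p

/-- Accept-reject on the remaining arms `S` and the accepted arms `T`, with empirical means `θ`. The
gaps and the acceptance threshold (the `K'`-th largest empirical mean on `S`, where `K' = K - |T|`)
are computed once, before the loop; each active pass removes an arm, so `|S|` passes complete the
loop. -/
noncomputable def acceptReject {n : ℕ} (K : ℕ) (θ : Fin n → ℝ) (S T : Finset (Fin n)) :
    Finset (Fin n) × Finset (Fin n) :=
  (arPass K S.card θ (empGap θ S (K - T.card)) (kthLargest θ S (K - T.card)))^[S.card] (S, T)

/-- The state of the main loop: the remaining arms, the accepted arms, the number of completed rounds
and the number of pulls that each remaining arm has received so far (it is the same number for all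
of them, and an upper bound for the number of pulls of every other arm). -/
structure OptMAIState (n : ℕ) where
  remaining : Finset (Fin n)
  accepted : Finset (Fin n)
  round : ℕ
  pulls : ℕ

/-- The rate at which the budgets of the rounds decrease. -/
noncomputable def optMAIRate : ℝ := 0.75 * Real.exp 0.2

/-- The number of pulls of each of the remaining arms in round `r` (rounds are numbered from `0`) if
`k` arms remain: the budget `β ^ r (1 - β) q` of the round is split equally and rounded down. -/
noncomputable def roundPulls (q r k : ℕ) : ℕ :=
  ⌊optMAIRate ^ r * (1 - optMAIRate) * (q : ℝ) / (k : ℝ)⌋₊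

/-- One round of the main loop. While fewer than `K` arms are accepted and arms remain, every
remaining arm is pulled afresh, and then quartile elimination is applied if more than `4 K` arms
remain, and accept-reject otherwise. -/
noncomputable def optMAIRound {n : ℕ} (K q : ℕ) (R : Fin n → ℕ → ℝ) (σ : OptMAIState n) :
    OptMAIState n :=
  if σ.accepted.card < K ∧ 0 < σ.remaining.card then
    let t := roundPulls q σ.round σ.remaining.card
    let θ := empMean R σ.pulls t
    if 4 * K < σ.remaining.card then
      ⟨quartileElim θ σ.remaining, ∅, σ.round + 1, σ.pulls + t⟩
    else
      ⟨(acceptReject K θ σ.remaining σ.accepted).1, (acceptReject K θ σ.remaining σ.accepted).2,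
        σ.round + 1, σ.pulls + t⟩
  else σ

/-- The final state of `OptMAI(n, K, q)` on the reward table `R`; its output is the set of accepted
arms. An active round removes at least one remaining arm, so `n` rounds complete the loop. -/
noncomputable def optMAI {n : ℕ} (K q : ℕ) (R : Fin n → ℕ → ℝ) : OptMAIState n :=
  (optMAIRound K q R)^[n] ⟨Finset.univ, ∅, 0, 0⟩

/-! ### Workers with classification noise and majority voting -/

/-- Persistent classification noise: `w i x` is the label that worker `i` gives to the data point `x`
whenever asked. It differs from the true label `c x` with probability `η i`, and the labels are
mutually independent over all workers and all data points. -/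
structure IsNoisyCrowd {Ω X : Type*} [MeasurableSpace Ω] (P : Measure Ω) {n : ℕ} (c : X → Bool)
    (η : Fin n → ℝ) (w : Fin n → X → Ω → Bool) : Prop where
  measurable_label : ∀ i x, Measurable (w i x)
  indep : iIndepFun (fun (p : Fin n × X) (ω : Ω) => w p.1 p.2 ω) P
  error : ∀ i x, P.real {ω | w i x ω ≠ c x} = η i

/-- The panels `M j` of workers that are asked to label the points `j = 0, …, s - 1`: each one is a
uniformly random set of `m` distinct workers, and the panels are drawn independently of the labels.
Nothing is required of the joint law of the panels: they may be independent of each other, or one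
and the same panel may label all the points. -/
structure IsRandomPanels {Ω X : Type*} [MeasurableSpace Ω] (P : Measure Ω) {n s : ℕ} (m : ℕ)
    (w : Fin n → X → Ω → Bool) (M : Fin s → Ω → Finset (Fin n)) : Prop where
  card_panel : ∀ j ω, (M j ω).card = m
  measurable_panel : ∀ j, Measurable (M j)
  uniform : ∀ j, ∀ A : Finset (Fin n), A.card = m → P.real {ω | M j ω = A} = 1 / (n.choose m : ℝ)
  indep : IndepFun (fun (ω : Ω) (j : Fin s) => M j ω)
    (fun (ω : Ω) (p : Fin n × X) => w p.1 p.2 ω) P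

/-- The majority vote of the workers in `A` on a data point, where `ℓ i` is the label of worker `i`
(a tie gives `false`). -/
def majorityVote {n : ℕ} (A : Finset (Fin n)) (ℓ : Fin n → Bool) : Bool :=
  decide (A.card < 2 * (A.filter (fun i => ℓ i = true)).card)

/-- The label of the point `y j` obtained by the majority vote of its panel. -/
def votedLabel {Ω X : Type*} {n s : ℕ} (w : Fin n → X → Ω → Bool) (M : Fin s → Ω → Finset (Fin n))
    (y : Fin s → X) (j : Fin s) (ω : Ω) : Bool :=
  majorityVote (M j ω) (fun i => w i (y j) ω)

/-- The total number of tasks given to workers in the voting phase: one for each point and each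
member of its panel. -/
def votingTasks {Ω : Type*} {n s : ℕ} (M : Fin s → Ω → Finset (Fin n)) (ω : Ω) : ℕ :=
  ∑ j, (M j ω).card

/-- The reward table for which the voted labels replace the true ones: the `j`-th pull of arm `i`
compares the label of worker `i` at the point `y j` with the voted label of that point. Only the `s`
points are available; the entries with `j ≥ s` are filled up with `0`. -/
def votedReward {Ω X : Type*} {n s : ℕ} (w : Fin n → X → Ω → Bool) (M : Fin s → Ω → Finset (Fin n))
    (y : Fin s → X) (ω : Ω) (i : Fin n) (j : ℕ) : ℝ :=
  if h : j < s then (if w i (y ⟨j, h⟩) ω = votedLabel w M y ⟨j, h⟩ ω then 1 else 0) else 0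

/-- The expression inside the soft-O bound; `e` stands for the average error rate of the crowd. -/
noncomputable def taskBound (n K : ℕ) (Δ δ e : ℝ) : ℝ :=
  (n : ℝ) ^ (0.7 : ℝ) * Real.log (1 / δ) * (1 + Real.log (1 / δ) / (K : ℝ)) /
    (Δ ^ 2 * (1 - 2 * e) ^ 2)

-- Two failures have to be excluded, each with probability at most `δ / 2`: a wrong vote, and a bad
-- run of the algorithm on the true labels. Votes and rewards use the same labels and are dependent,
-- so nothing is conditioned on correct votes: the algorithm is analysed on the ideal table of
-- independent rewards, which equals the voted one when all votes are right, and a union bound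
-- finishes (`measure_voted_success_ge`).
--
-- The algorithm. Call a `K`-set feasible if it can still be output. Each round preserves a feasible
-- set up to a loss of `K * ε r` in the sum of true means (`LoopInvariant.exists_feasible`), and the
-- `ε r` sum to at most `Δ`. Quartile elimination loses little because fewer than a quarter of the
-- arms are badly overestimated, so good substitutes survive. Accept-reject loses nothing in
-- empirical sums, by exchange. Every active round starts with a deterministic number of arms, so it
-- reads a deterministic block of pulls, independent of the state before it; Hoeffding's inequality
-- and a union bound over sets of arms then control the round (`measure_not_isGoodRound_le`,
-- `measure_not_isGoodAt_le`). The pulls per arm grow at least like `(6/5)^r`, faster than `ε r ^ 2`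
-- decays, so the failure probabilities are summable. At the same time `exp 0.2 ^ r ≤ n ^ 0.7` as
-- long as an arm remains, which gives the pull bound `25 q / n ^ 0.3` (`pullCount_le`).
--
-- The vote. For a fixed panel, Chernoff's method bounds the error by a product of moment generating
-- functions over its members. Averaging over all panels gives a normalised elementary symmetric
-- polynomial, and Maclaurin's inequality bounds it by the power of the mean, as if each member had
-- the average error rate (`measure_votedLabel_ne_le`). The number of tasks is `s * m` (`tasks_le`).

/-! ### Order statistics -/

section OrderStatistics

variable {n : ℕ} (θ : Fin n → ℝ) (S : Finset (Fin n))

/-- The values of `θ` on `S` in decreasing order. -/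
noncomputable def sortedValues : List ℝ := (S.val.map θ).sort (fun x y => y ≤ x)

lemma kthLargest_eq (k : ℕ) : kthLargest θ S k = (sortedValues θ S).getD (k - 1) 0 := rfl

lemma length_sortedValues : (sortedValues θ S).length = S.card := by
  simp [sortedValues]

lemma pairwise_sortedValues : (sortedValues θ S).Pairwise (fun x y => y ≤ x) :=
  Multiset.pairwise_sort _ _

lemma coe_sortedValues : ((sortedValues θ S : List ℝ) : Multiset ℝ) = S.val.map θ :=
  Multiset.sort_eq _ _

lemma mem_sortedValues {i : Fin n} (hi : i ∈ S) : θ i ∈ sortedValues θ S := by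
  rw [← Multiset.mem_coe, coe_sortedValues]
  exact Multiset.mem_map_of_mem _ hi

variable {θ S}

lemma getD_sortedValues_antitone {i j : ℕ} (hij : i ≤ j) (hj : j < S.card) :
    (sortedValues θ S).getD j 0 ≤ (sortedValues θ S).getD i 0 := by
  have hl := length_sortedValues θ S
  rcases hij.eq_or_lt with rfl | h
  · exact le_rfl
  rw [List.getD_eq_getElem _ _ (by omega), List.getD_eq_getElem _ _ (by omega)]
  exact List.pairwise_iff_getElem.mp (pairwise_sortedValues θ S) i j (by omega) (by omega) h

lemma kthLargest_of_card_lt {k : ℕ} (h : S.card < k) : kthLargest θ S k = 0 := by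
  rw [kthLargest_eq, List.getD_eq_default]
  rw [length_sortedValues]; omega

lemma exists_eq_getD_sortedValues {i : Fin n} (hi : i ∈ S) :
    ∃ j < S.card, θ i = (sortedValues θ S).getD j 0 := by
  obtain ⟨j, hj, h⟩ := List.mem_iff_getElem.mp (mem_sortedValues θ S hi)
  rw [length_sortedValues] at hj
  refine ⟨j, hj, ?_⟩
  rw [List.getD_eq_getElem _ _ (by rw [length_sortedValues]; exact hj), h]

/-- No value lies strictly between consecutive order statistics: an arm below the `k`-th value sits
at a later position of the sorted list. -/
lemma le_kthLargest_succ_of_lt {k : ℕ} (hk : 1 ≤ k) (hkS : k ≤ S.card) {i : Fin n} (hi : i ∈ S)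
    (h : θ i < kthLargest θ S k) : θ i ≤ kthLargest θ S (k + 1) := by
  obtain ⟨j, hj, hij⟩ := exists_eq_getD_sortedValues (θ := θ) hi
  rw [kthLargest_eq] at h ⊢
  have hjk : k - 1 < j := by
    by_contra! hc
    exact absurd (getD_sortedValues_antitone (θ := θ) (S := S) hc (by omega))
      (by rw [← hij]; exact not_le.mpr h)
  rw [hij]
  exact getD_sortedValues_antitone (by omega) hj

lemma kthLargest_nonneg (h : ∀ i ∈ S, 0 ≤ θ i) (k : ℕ) : 0 ≤ kthLargest θ S k := by
  rw [kthLargest_eq]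
  by_cases hk : k - 1 < (sortedValues θ S).length
  · rw [List.getD_eq_getElem _ _ hk]
    have : (sortedValues θ S)[k - 1] ∈ S.val.map θ := by
      rw [← coe_sortedValues, Multiset.mem_coe]
      exact List.getElem_mem hk
    obtain ⟨i, hi, hi'⟩ := Multiset.mem_map.mp this
    rw [← hi']
    exact h i hi
  · rw [List.getD_eq_default _ _ (by omega)]

/-- Nonnegativity matters only at the end of the list, where the default value 0 must not exceed the
last entry. -/
lemma kthLargest_succ_le (h : ∀ i ∈ S, 0 ≤ θ i) (k : ℕ) :
    kthLargest θ S (k + 1) ≤ kthLargest θ S k := by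
  by_cases hk : k < S.card
  · rw [kthLargest_eq, kthLargest_eq]
    exact getD_sortedValues_antitone (by omega) (by omega)
  · rw [kthLargest_of_card_lt (by omega : S.card < k + 1)]
    exact kthLargest_nonneg h k

/-- The first `k` entries of the sorted list are at least the `k`-th; ties can only add more. This
guarantees enough acceptable arms for accept-reject. -/
lemma le_card_filter_kthLargest_le {k : ℕ} (hk : k ≤ S.card) :
    k ≤ (S.filter (fun i => kthLargest θ S k ≤ θ i)).card := by
  classical
  have hl := length_sortedValues θ S
  have h1 : (S.filter (fun i => kthLargest θ S k ≤ θ i)).card =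
      (sortedValues θ S).countP (fun x => decide (kthLargest θ S k ≤ x)) := by
    rw [← Multiset.coe_countP, coe_sortedValues, Multiset.countP_map]
    rfl
  rw [h1]
  have h2 : ((sortedValues θ S).take k).countP (fun x => decide (kthLargest θ S k ≤ x)) =
      ((sortedValues θ S).take k).length := by
    rw [List.countP_eq_length]
    intro x hx
    obtain ⟨j, hj, rfl⟩ := List.mem_iff_getElem.mp hx
    rw [List.length_take] at hj
    rw [List.getElem_take, decide_eq_true_iff, kthLargest_eq,
      ← List.getD_eq_getElem _ 0 (by omega)]
    exact getD_sortedValues_antitone (by omega) (by omega)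
  calc k = ((sortedValues θ S).take k).length := by rw [List.length_take]; omega
    _ ≤ _ := by rw [← h2]; exact (List.take_sublist _ _).countP_le

/-! ### Quartile elimination -/

lemma armRank_lt_of_above {i j : Fin n} (hj : j ∈ S)
    (h : θ i < θ j ∨ (θ i = θ j ∧ j < i)) : armRank θ S j < armRank θ S i := by
  classical
  unfold armRank
  apply Finset.card_lt_card
  rw [Finset.ssubset_iff_of_subset]
  · refine ⟨j, ?_, ?_⟩
    · simp only [Finset.mem_filter]; exact ⟨hj, h⟩
    · simp
  · intro l hl
    simp only [Finset.mem_filter] at hl ⊢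
    refine ⟨hl.1, ?_⟩
    rcases hl.2 with h1 | ⟨h1, h2⟩ <;> rcases h with h3 | ⟨h3, h4⟩
    · left; linarith
    · left; linarith
    · left; linarith
    · right; exact ⟨by linarith, h2.trans h4⟩

lemma armRank_injOn : Set.InjOn (armRank θ S) S := by
  intro i hi j hj hij
  by_contra hne
  rcases lt_trichotomy (θ i) (θ j) with h | h | h
  · exact absurd hij (armRank_lt_of_above hj (Or.inl h)).ne'
  · rcases lt_or_gt_of_ne hne with h' | h'
    · exact absurd hij (armRank_lt_of_above hi (Or.inr ⟨h.symm, h'⟩)).ne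
    · exact absurd hij (armRank_lt_of_above hj (Or.inr ⟨h, h'⟩)).ne'
  · exact absurd hij (armRank_lt_of_above hi (Or.inl h)).ne

lemma armRank_lt_card {i : Fin n} (hi : i ∈ S) : armRank θ S i < S.card := by
  classical
  unfold armRank
  apply Finset.card_lt_card
  rw [Finset.ssubset_iff_of_subset (Finset.filter_subset _ _)]
  exact ⟨i, hi, by simp⟩

/-- Tie-breaking by index makes ranks injective, so they exhaust an initial segment of ℕ;
elimination therefore keeps an exact number of arms even with ties. -/
lemma image_armRank : S.image (armRank θ S) = Finset.range S.card := by
  apply Finset.eq_of_subset_of_card_le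
  · intro r hr
    obtain ⟨i, hi, rfl⟩ := Finset.mem_image.mp hr
    exact Finset.mem_range.mpr (armRank_lt_card hi)
  · rw [Finset.card_range, Finset.card_image_of_injOn armRank_injOn]

lemma card_filter_armRank_lt {k : ℕ} (hk : k ≤ S.card) :
    (S.filter (fun i => armRank θ S i < k)).card = k := by
  classical
  rw [← Finset.card_image_of_injOn
    (armRank_injOn.mono (by exact_mod_cast Finset.filter_subset _ _)) (f := armRank θ S)]
  have : (S.filter (fun i => armRank θ S i < k)).image (armRank θ S) = Finset.range k := by
    ext r
    have hr : r ∈ S.image (armRank θ S) ↔ r ∈ Finset.range S.card := by rw [image_armRank]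
    simp only [Finset.mem_image, Finset.mem_range, Finset.mem_filter] at hr ⊢
    constructor
    · rintro ⟨i, hi, rfl⟩
      exact hi.2
    · intro h
      obtain ⟨i, hi, rfl⟩ := hr.mpr (h.trans_le hk)
      exact ⟨i, ⟨hi, h⟩, rfl⟩
  rw [this, Finset.card_range]

lemma quartileElim_subset : quartileElim θ S ⊆ S := Finset.filter_subset _ _

lemma card_quartileElim : (quartileElim θ S).card = 3 * S.card / 4 := by
  unfold quartileElim
  convert card_filter_armRank_lt (θ := θ) (S := S) (k := 3 * S.card / 4) (by omega)

lemma le_of_notMem_quartileElim {i j : Fin n} (hi : i ∈ quartileElim θ S) (hj : j ∈ S)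
    (hj' : j ∉ quartileElim θ S) : θ j ≤ θ i := by
  classical
  simp only [quartileElim, Finset.mem_filter, not_and, not_lt] at hi hj'
  by_contra! h
  have := armRank_lt_of_above (θ := θ) hj (Or.inl h)
  have := hj' hj
  omega

end OrderStatistics

/-! ### Accept-reject -/

/-- `F` is a set of `K` arms that can still be output when the arms of `S` remain and those of `T`
are accepted. -/
def IsFeasible {n : ℕ} (K : ℕ) (S T F : Finset (Fin n)) : Prop :=
  T ⊆ F ∧ F ⊆ S ∪ T ∧ F.card = K

section AcceptReject

variable {n : ℕ}

lemma firstArgmax_mem (g : Fin n → ℝ) (S : Finset (Fin n)) (hS : S.Nonempty) :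
    firstArgmax g S hS ∈ S ∧ ∀ j ∈ S, g j ≤ g (firstArgmax g S hS) := by
  classical
  have h := Finset.min'_mem (S.filter (fun i => ∀ j ∈ S, g j ≤ g i)) (by
    obtain ⟨i, hi, h⟩ := S.exists_max_image g hS
    exact ⟨i, Finset.mem_filter.mpr ⟨hi, h⟩⟩)
  have h2 : firstArgmax g S hS ∈ S.filter (fun i => ∀ j ∈ S, g j ≤ g i) := by
    unfold firstArgmax
    convert h
  exact Finset.mem_filter.mp h2

lemma IsFeasible.exists_swap [DecidableEq (Fin n)] {K : ℕ} {F : Finset (Fin n)} {θ : Fin n → ℝ}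
    {a c : Fin n} (hF : F.card = K) (hc : c ∈ F) (ha : a ∉ F) (h : θ c ≤ θ a) :
    (insert a (F.erase c)).card = K ∧ ∑ i ∈ F, θ i ≤ ∑ i ∈ insert a (F.erase c), θ i := by
  have ha' : a ∉ F.erase c := fun h => ha (Finset.mem_of_mem_erase h)
  constructor
  · rw [Finset.card_insert_of_notMem ha', Finset.card_erase_add_one hc, hF]
  · rw [Finset.sum_insert ha', ← Finset.add_sum_erase F θ hc]
    linarith

/-- What one pass of accept-reject preserves. -/
structure PassInvariant (K : ℕ) (θ : Fin n → ℝ) (v : ℝ) (S T : Finset (Fin n))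
    (p : Finset (Fin n) × Finset (Fin n)) : Prop where
  subset : p.1 ⊆ S
  disjoint : Disjoint p.1 p.2
  card_le : p.2.card ≤ K
  le_card : K ≤ (p.1.filter (fun i => v ≤ θ i)).card + p.2.card
  lower : 3 * S.card / 4 ≤ p.1.card
  union_subset : p.2 ⊆ S ∪ T
  subset_accepted : T ⊆ p.2
  best : ∀ F, IsFeasible K S T F → ∃ F', IsFeasible K p.1 p.2 F' ∧ ∑ i ∈ F, θ i ≤ ∑ i ∈ F', θ i

/-- Exchange argument. By `hacc` and `hrej` the removed arm is empirically the best remaining one if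
accepted and the worst if rejected. In the first case it is swapped into the feasible set for a
member not yet accepted, in the second it is swapped out for a remaining arm; neither lowers the
empirical sum. -/
lemma PassInvariant.step {K : ℕ} {θ g : Fin n → ℝ} {v : ℝ} {S T : Finset (Fin n)}
    {p : Finset (Fin n) × Finset (Fin n)}
    (hacc : ∀ a ∈ S, ∀ c ∈ S, g c ≤ g a → v ≤ θ a → θ c ≤ θ a)
    (hrej : ∀ a ∈ S, ∀ c ∈ S, g c ≤ g a → θ a < v → θ a ≤ θ c)
    (hp : PassInvariant K θ v S T p) : PassInvariant K θ v S T (arPass K S.card θ g v p) := by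
  classical
  unfold arPass
  split_ifs with h
  swap
  · exact hp
  obtain ⟨S', T'⟩ := p
  have hne : S'.Nonempty := Finset.card_pos.mp (by have := h.2; simp only at this; omega)
  obtain ⟨ha, hmax⟩ := firstArgmax_mem g S' hne
  simp only at h ⊢
  set a := firstArgmax g S' hne with hadef
  have hsub := hp.subset
  have hdisj := hp.disjoint
  have hle := hp.le_card
  have hlow := hp.lower
  simp only at hsub hdisj hle hlow
  have haT : a ∉ T' := Finset.disjoint_left.mp hdisj ha
  have hcardS : (S'.erase a).card + 1 = S'.card := Finset.card_erase_add_one ha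
  have hlow' : 3 * S.card / 4 ≤ (S'.erase a).card := by omega
  by_cases hv : v ≤ θ a
  · rw [if_pos hv]
    have htop : ∀ c ∈ S', θ c ≤ θ a := fun c hc =>
      hacc a (hsub ha) c (hsub hc) (hmax c hc) hv
    have hcT : (insert a T').card = T'.card + 1 := Finset.card_insert_of_notMem haT
    refine ⟨(Finset.erase_subset _ _).trans hsub, ?_, ?_, ?_, hlow', ?_, ?_, ?_⟩
    · simp only [Finset.disjoint_insert_right, Finset.mem_erase, ne_eq, not_true_eq_false,
        false_and, not_false_eq_true, true_and]
      exact hdisj.mono_left (Finset.erase_subset _ _)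
    · simp only [hcT]; omega
    · have : ((S'.erase a).filter (fun i => v ≤ θ i)).card + 1 =
          (S'.filter (fun i => v ≤ θ i)).card := by
        rw [Finset.filter_erase]
        exact Finset.card_erase_add_one (Finset.mem_filter.mpr ⟨ha, hv⟩)
      simp only [hcT]; omega
    · exact Finset.insert_subset (Finset.mem_union_left _ (hsub ha)) hp.union_subset
    · exact hp.subset_accepted.trans (Finset.subset_insert _ _)
    · intro F hF
      obtain ⟨F', ⟨h1, h2, h3⟩, h4⟩ := hp.best F hF
      simp only at h1 h2
      by_cases haF : a ∈ F'
      · refine ⟨F', ⟨Finset.insert_subset haF h1, ?_, h3⟩, h4⟩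
        intro i hi
        have := h2 hi
        simp only [Finset.mem_union, Finset.mem_erase, Finset.mem_insert] at this ⊢
        tauto
      · obtain ⟨c, hcF, hcT'⟩ : ∃ c ∈ F', c ∉ T' := by
          by_contra! hcon
          have := Finset.card_le_card (show F' ⊆ T' from hcon)
          omega
        have hcS : c ∈ S' := by
          have := h2 hcF
          simp only [Finset.mem_union] at this
          tauto
        obtain ⟨h5, h6⟩ := IsFeasible.exists_swap h3 hcF haF (htop c hcS)
        refine ⟨_, ⟨?_, ?_, h5⟩, h4.trans h6⟩
        · apply Finset.insert_subset_insert
          intro i hi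
          refine Finset.mem_erase.mpr ⟨?_, h1 hi⟩
          rintro rfl
          exact hcT' hi
        · intro i hi
          simp only [Finset.mem_insert, Finset.mem_erase, Finset.mem_union] at hi ⊢
          rcases hi with rfl | ⟨hi1, hi2⟩
          · tauto
          · have := h2 hi2
            simp only [Finset.mem_union] at this
            tauto
  · rw [if_neg hv]
    have hbot : ∀ c ∈ S', θ a ≤ θ c := fun c hc =>
      hrej a (hsub ha) c (hsub hc) (hmax c hc) (not_le.mp hv)
    have hfil : (S'.erase a).filter (fun i => v ≤ θ i) = S'.filter (fun i => v ≤ θ i) := by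
      rw [Finset.filter_erase, Finset.erase_eq_of_notMem]
      simp [hv]
    refine ⟨(Finset.erase_subset _ _).trans hsub, hdisj.mono_left (Finset.erase_subset _ _),
      hp.card_le, ?_, hlow', hp.union_subset, hp.subset_accepted, ?_⟩
    · simp only [hfil]; exact hle
    · intro F hF
      obtain ⟨F', ⟨h1, h2, h3⟩, h4⟩ := hp.best F hF
      simp only at h1 h2
      by_cases haF : a ∈ F'
      -- If no substitute existed, `F'` would contain `a`, all accepted arms and all remaining arms
      -- above the threshold, which by `le_card` are more than `K` arms.
      · obtain ⟨c, hcS, hcF⟩ : ∃ c ∈ S'.erase a, c ∉ F' := by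
          by_contra! hcon
          have h5 : insert a (S'.filter (fun i => v ≤ θ i) ∪ T') ⊆ F' := by
            apply Finset.insert_subset haF
            apply Finset.union_subset _ h1
            rw [← hfil]
            exact (Finset.filter_subset _ _).trans hcon
          have h6 := Finset.card_le_card h5
          rw [Finset.card_insert_of_notMem, Finset.card_union_of_disjoint] at h6
          · omega
          · exact hdisj.mono_left (Finset.filter_subset _ _)
          · simp [hv, haT]
        have hcS' := Finset.mem_of_mem_erase hcS
        obtain ⟨h5, h6⟩ := IsFeasible.exists_swap h3 haF hcF (hbot c hcS')
        refine ⟨_, ⟨?_, ?_, h5⟩, h4.trans h6⟩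
        · intro i hi
          refine Finset.mem_insert_of_mem (Finset.mem_erase.mpr ⟨?_, h1 hi⟩)
          rintro rfl
          exact haT hi
        · intro i hi
          simp only [Finset.mem_insert, Finset.mem_erase, Finset.mem_union] at hi hcS ⊢
          rcases hi with rfl | ⟨hi1, hi2⟩
          · tauto
          · have := h2 hi2
            simp only [Finset.mem_union] at this
            tauto
      · refine ⟨F', ⟨h1, ?_, h3⟩, h4⟩
        intro i hi
        have h7 := h2 hi
        have : i ≠ a := by rintro rfl; exact haF hi
        simp only [Finset.mem_union, Finset.mem_erase] at h7 ⊢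
        tauto

/-- At or above the threshold the gap of `a` is its distance to the fixed `(k+1)`-st value, and the
gap of `c` is at least the analogous difference, so the order of gaps passes to the means. -/
lemma empGap_accept {θ : Fin n → ℝ} {S : Finset (Fin n)} (hθ : ∀ i ∈ S, 0 ≤ θ i) (k : ℕ)
    {a c : Fin n} (hg : empGap θ S k c ≤ empGap θ S k a) (ha : kthLargest θ S k ≤ θ a) :
    θ c ≤ θ a := by
  have h := kthLargest_succ_le hθ k
  have h1 : empGap θ S k a = θ a - kthLargest θ S (k + 1) := max_eq_left (by linarith)
  have h2 : θ c - kthLargest θ S (k + 1) ≤ empGap θ S k c := le_max_left _ _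
  linarith

lemma empGap_reject {θ : Fin n → ℝ} {S : Finset (Fin n)} {k : ℕ}
    (hk : 1 ≤ k) (hkS : k ≤ S.card) {a c : Fin n} (haS : a ∈ S)
    (hg : empGap θ S k c ≤ empGap θ S k a) (ha : θ a < kthLargest θ S k) :
    θ a ≤ θ c := by
  have h := le_kthLargest_succ_of_lt hk hkS haS ha
  have h1 : empGap θ S k a = kthLargest θ S k - θ a := max_eq_right (by linarith)
  have h2 : kthLargest θ S k - θ c ≤ empGap θ S k c := le_max_right _ _
  linarith

lemma PassInvariant.acceptReject {K : ℕ} {θ : Fin n → ℝ} {S T : Finset (Fin n)}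
    (hθ : ∀ i ∈ S, 0 ≤ θ i) (hST : Disjoint S T) (hT : T.card < K) (hK : K ≤ S.card + T.card) :
    PassInvariant K θ (kthLargest θ S (K - T.card)) S T (acceptReject K θ S T) := by
  have h0 : PassInvariant K θ (kthLargest θ S (K - T.card)) S T (S, T) := by
    refine ⟨subset_rfl, hST, hT.le, ?_, by simp only; omega, Finset.subset_union_right, subset_rfl,
      fun F hF => ⟨F, hF, le_rfl⟩⟩
    have := le_card_filter_kthLargest_le (θ := θ) (S := S) (k := K - T.card) (by omega)
    simp only
    omega
  unfold _root_.acceptReject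
  refine Function.Iterate.rec (fun p => PassInvariant K θ (kthLargest θ S (K - T.card)) S T p)
    h0 (fun p hp => hp.step ?_ ?_) S.card
  · exact fun a _ c _ hg ha => empGap_accept hθ _ hg ha
  · exact fun a ha c _ hg ha' => empGap_reject (by omega) (by omega) ha hg ha'

lemma arPass_of_inactive {K s : ℕ} {θ g : Fin n → ℝ} {v : ℝ}
    {p : Finset (Fin n) × Finset (Fin n)} (h : ¬(p.2.card < K ∧ 3 * s < 4 * p.1.card)) :
    arPass K s θ g v p = p := by
  unfold arPass
  rw [dif_neg h]

lemma card_arPass_of_active {K s : ℕ} {θ g : Fin n → ℝ} {v : ℝ}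
    {p : Finset (Fin n) × Finset (Fin n)} (h : p.2.card < K ∧ 3 * s < 4 * p.1.card) :
    (arPass K s θ g v p).1.card + 1 = p.1.card := by
  unfold arPass
  rw [dif_pos h]
  exact Finset.card_erase_add_one (firstArgmax_mem g p.1 _).1

/-- Each active pass consumes one arm, so `|S|` passes suffice for the loop to come to rest. -/
lemma iterate_arPass_inactive_or_card {K s : ℕ} {θ g : Fin n → ℝ} {v : ℝ}
    (p : Finset (Fin n) × Finset (Fin n)) (j : ℕ) :
    ¬(((arPass K s θ g v)^[j] p).2.card < K ∧ 3 * s < 4 * ((arPass K s θ g v)^[j] p).1.card) ∨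
      ((arPass K s θ g v)^[j] p).1.card + j = p.1.card := by
  induction j with
  | zero => right; rfl
  | succ j ih =>
    rw [Function.iterate_succ_apply']
    by_cases h : ((arPass K s θ g v)^[j] p).2.card < K ∧
        3 * s < 4 * ((arPass K s θ g v)^[j] p).1.card
    · right
      have := card_arPass_of_active (θ := θ) (g := g) (v := v) h
      rcases ih with ih | ih
      · exact absurd h ih
      · omega
    · left
      rw [arPass_of_inactive h]
      exact h

lemma card_acceptReject_le {K : ℕ} {θ : Fin n → ℝ} {S T : Finset (Fin n)}
    (h : (acceptReject K θ S T).2.card < K) :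
    4 * (acceptReject K θ S T).1.card ≤ 3 * S.card := by
  rcases iterate_arPass_inactive_or_card (K := K) (s := S.card) (θ := θ)
    (g := empGap θ S (K - T.card)) (v := kthLargest θ S (K - T.card)) (S, T) S.card with h1 | h1
  · by_contra! h2
    exact h1 ⟨h, h2⟩
  · have h2 : (acceptReject K θ S T).1.card + S.card = S.card := h1
    omega

end AcceptReject

/-! ### One round of the main loop -/

section Round

variable {n : ℕ}

lemma sum_le_sum_of_card_eq_of_forall_le {θ : Fin n → ℝ} {A B : Finset (Fin n)}
    (hcard : A.card = B.card) (h : ∀ a ∈ A, ∀ b ∈ B, θ a ≤ θ b) :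
    ∑ i ∈ A, θ i ≤ ∑ i ∈ B, θ i := by
  rcases A.eq_empty_or_nonempty with rfl | hA
  · rw [Finset.card_empty] at hcard
    rw [Finset.card_eq_zero.mp hcard.symm]
  · obtain ⟨c, hc, hmax⟩ := A.exists_max_image θ hA
    calc ∑ i ∈ A, θ i ≤ A.card • θ c := Finset.sum_le_card_nsmul _ _ _ hmax
      _ = B.card • θ c := by rw [hcard]
      _ ≤ ∑ i ∈ B, θ i := Finset.card_nsmul_le_sum _ _ _ (h c hc)

/-- The empirical means `θ` deviate so little from the true means `μ` that a round on the remaining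
arms `S` loses at most `K * ε` against the set `F`. -/
def IsGoodRound (K : ℕ) (ε : ℝ) (θ μ : Fin n → ℝ) (S F : Finset (Fin n)) : Prop :=
  if 4 * K < S.card then
    (∀ A ⊆ F, ∑ i ∈ A, (μ i - θ i) < K * ε / 2) ∧
      ∀ D ⊆ S, S.card ≤ 4 * D.card → ∑ i ∈ D, (θ i - μ i) < D.card * ε / 2
  else
    (∀ A ⊆ S, ∑ i ∈ A, (μ i - θ i) < K * ε / 2) ∧ ∀ A ⊆ S, ∑ i ∈ A, (θ i - μ i) < K * ε / 2

/-- The eliminated members of `F` are replaced by surviving arms that look at least as good and are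
overestimated by less than `ε / 2`. Underestimation of the former and overestimation of the latter
cost `K * ε / 2` each. -/
lemma quartileElim_exists_feasible {K : ℕ} {ε : ℝ} {θ μ : Fin n → ℝ} {S F : Finset (Fin n)}
    (hε : 0 ≤ ε) (hS : 4 * K < S.card) (hF : IsFeasible K S ∅ F) (hgood : IsGoodRound K ε θ μ S F) :
    ∃ F', IsFeasible K (quartileElim θ S) ∅ F' ∧ ∑ i ∈ F, μ i - K * ε ≤ ∑ i ∈ F', μ i := by
  classical
  rw [IsGoodRound, if_pos hS] at hgood
  obtain ⟨hlow, hup⟩ := hgood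
  obtain ⟨-, hFS, hFc⟩ := hF
  rw [Finset.union_empty] at hFS
  set V := quartileElim θ S with hV
  have hVc : V.card = 3 * S.card / 4 := card_quartileElim
  set D := S.filter (fun i => ε / 2 ≤ θ i - μ i) with hD
  -- Otherwise `D` would itself be one of the large sets whose total overestimation is controlled.
  have hDc : 4 * D.card < S.card := by
    by_contra! h
    have h1 := hup D (Finset.filter_subset _ _) h
    have h2 : D.card • (ε / 2) ≤ ∑ i ∈ D, (θ i - μ i) :=
      Finset.card_nsmul_le_sum _ _ _ fun i hi => (Finset.mem_filter.mp hi).2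
    rw [nsmul_eq_mul] at h2
    linarith
  have hsplit : (F ∩ V).card + (F \ V).card = K := by
    rw [Finset.card_inter_add_card_sdiff, hFc]
  -- About `3|S|/4` arms survive, fewer than `|S|/4` are in `D`, and `|S| > 4K`; this leaves room
  -- for `K` arms, counting those of `F ∩ V`.
  have hG : (F \ V).card ≤ (V \ (F ∩ V ∪ D)).card := by
    have h1 := Finset.le_card_sdiff (F ∩ V ∪ D) V
    have h2 := Finset.card_union_le (F ∩ V) D
    omega
  obtain ⟨B, hB, hBc⟩ := Finset.exists_subset_card_eq hG
  have hBV : ∀ b ∈ B, b ∈ V ∧ b ∉ F ∧ b ∉ D := by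
    intro b hb
    have := hB hb
    simp only [Finset.mem_sdiff, Finset.mem_union, Finset.mem_inter] at this
    tauto
  have hdisj : Disjoint (F ∩ V) B := by
    rw [Finset.disjoint_left]
    intro i hi hb
    exact (hBV i hb).2.1 (Finset.mem_inter.mp hi).1
  refine ⟨F ∩ V ∪ B, ⟨Finset.empty_subset _, ?_, ?_⟩, ?_⟩
  · rw [Finset.union_empty]
    exact Finset.union_subset Finset.inter_subset_right fun b hb => (hBV b hb).1
  · rw [Finset.card_union_of_disjoint hdisj, hBc, hsplit]
  · rw [Finset.sum_union hdisj, ← Finset.sum_inter_add_sum_sdiff F V μ]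
    have h1 := hlow (F \ V) Finset.sdiff_subset
    rw [Finset.sum_sub_distrib] at h1
    have h2 : ∑ i ∈ F \ V, θ i ≤ ∑ i ∈ B, θ i := by
      refine sum_le_sum_of_card_eq_of_forall_le hBc.symm fun a ha b hb => ?_
      rw [Finset.mem_sdiff] at ha
      exact le_of_notMem_quartileElim (hBV b hb).1 (hFS ha.1) ha.2
    have h3 : ∑ i ∈ B, (θ i - μ i) ≤ B.card • (ε / 2) := by
      refine Finset.sum_le_card_nsmul _ _ _ fun b hb => ?_
      by_contra! h
      exact (hBV b hb).2.2 (Finset.mem_filter.mpr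
        ⟨quartileElim_subset (hBV b hb).1, h.le⟩)
    rw [Finset.sum_sub_distrib, nsmul_eq_mul] at h3
    have h4 : (B.card : ℝ) * (ε / 2) ≤ K * (ε / 2) := by
      gcongr
      omega
    linarith

/-- The empirical sum does not drop, and both sets contain `T`; hence only the deviations on `F \ T`
and `F' \ T`, which are subsets of `S`, contribute. -/
lemma acceptReject_exists_feasible {K : ℕ} {ε : ℝ} {θ μ : Fin n → ℝ} {S T F : Finset (Fin n)}
    (hS : ¬ 4 * K < S.card) (hp : PassInvariant K θ (kthLargest θ S (K - T.card)) S T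
      (acceptReject K θ S T)) (hF : IsFeasible K S T F) (hgood : IsGoodRound K ε θ μ S F) :
    ∃ F', IsFeasible K (acceptReject K θ S T).1 (acceptReject K θ S T).2 F' ∧
      ∑ i ∈ F, μ i - K * ε ≤ ∑ i ∈ F', μ i := by
  classical
  rw [IsGoodRound, if_neg hS] at hgood
  obtain ⟨hlow, hup⟩ := hgood
  obtain ⟨F', hF', hle⟩ := hp.best F hF
  refine ⟨F', hF', ?_⟩
  have hTF' : T ⊆ F' := hp.subset_accepted.trans hF'.1
  have h1 : F \ T ⊆ S := by
    intro i hi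
    rw [Finset.mem_sdiff] at hi
    have := hF.2.1 hi.1
    simp only [Finset.mem_union] at this
    tauto
  have h2 : F' \ T ⊆ S := by
    intro i hi
    rw [Finset.mem_sdiff] at hi
    have h3 := hF'.2.1 hi.1
    rcases Finset.mem_union.mp h3 with h | h
    · exact hp.subset h
    · have := hp.union_subset h
      simp only [Finset.mem_union] at this
      tauto
  have h3 := hlow _ h1
  have h4 := hup _ h2
  rw [Finset.sum_sub_distrib] at h3 h4
  rw [← Finset.sum_sdiff hF.1, ← Finset.sum_sdiff hTF'] at hle ⊢
  linarith

/-- The main loop goes on. -/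
def OptMAIState.IsActive (K : ℕ) (σ : OptMAIState n) : Prop :=
  σ.accepted.card < K ∧ 0 < σ.remaining.card

/-- The sets of remaining and accepted arms stay consistent. -/
structure LoopInvariant (K : ℕ) (σ : OptMAIState n) : Prop where
  disjoint : Disjoint σ.remaining σ.accepted
  le_card : K ≤ σ.remaining.card + σ.accepted.card
  accepted_empty : 4 * K < σ.remaining.card → σ.accepted = ∅

/-- The empirical means of the next round. -/
noncomputable def nextMean (q : ℕ) (R : Fin n → ℕ → ℝ) (σ : OptMAIState n) : Fin n → ℝ :=
  empMean R σ.pulls (roundPulls q σ.round σ.remaining.card)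

lemma optMAIRound_of_inactive {K q : ℕ} {R : Fin n → ℕ → ℝ} {σ : OptMAIState n}
    (h : ¬ σ.IsActive K) : optMAIRound K q R σ = σ := by
  unfold optMAIRound
  exact if_neg h

lemma optMAIRound_of_quartile {K q : ℕ} {R : Fin n → ℕ → ℝ} {σ : OptMAIState n}
    (h : σ.IsActive K) (h4 : 4 * K < σ.remaining.card) :
    optMAIRound K q R σ = ⟨quartileElim (nextMean q R σ) σ.remaining, ∅, σ.round + 1,
      σ.pulls + roundPulls q σ.round σ.remaining.card⟩ := by
  unfold optMAIRound
  exact (if_pos h).trans (if_pos h4)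

lemma optMAIRound_of_acceptReject {K q : ℕ} {R : Fin n → ℕ → ℝ} {σ : OptMAIState n}
    (h : σ.IsActive K) (h4 : ¬ 4 * K < σ.remaining.card) :
    optMAIRound K q R σ = ⟨(acceptReject K (nextMean q R σ) σ.remaining σ.accepted).1,
      (acceptReject K (nextMean q R σ) σ.remaining σ.accepted).2, σ.round + 1,
      σ.pulls + roundPulls q σ.round σ.remaining.card⟩ := by
  unfold optMAIRound
  exact (if_pos h).trans (if_neg h4)

lemma empMean_nonneg {R : Fin n → ℕ → ℝ} (hR : ∀ i j, 0 ≤ R i j) (a t : ℕ) (i : Fin n) :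
    0 ≤ empMean R a t i :=
  div_nonneg (Finset.sum_nonneg fun j _ => hR i j) (Nat.cast_nonneg t)

lemma LoopInvariant.passInvariant {K q : ℕ} {R : Fin n → ℕ → ℝ} {σ : OptMAIState n}
    (hσ : LoopInvariant K σ) (hR : ∀ i j, 0 ≤ R i j) (h : σ.IsActive K) :
    PassInvariant K (nextMean q R σ)
      (kthLargest (nextMean q R σ) σ.remaining (K - σ.accepted.card)) σ.remaining σ.accepted
      (acceptReject K (nextMean q R σ) σ.remaining σ.accepted) :=
  PassInvariant.acceptReject (fun i _ => empMean_nonneg hR _ _ i) hσ.disjoint h.1 hσ.le_card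

lemma LoopInvariant.step {K q : ℕ} {R : Fin n → ℕ → ℝ} {σ : OptMAIState n}
    (hσ : LoopInvariant K σ) (hR : ∀ i j, 0 ≤ R i j) :
    LoopInvariant K (optMAIRound K q R σ) := by
  by_cases h : σ.IsActive K
  swap
  · rwa [optMAIRound_of_inactive h]
  by_cases h4 : 4 * K < σ.remaining.card
  · rw [optMAIRound_of_quartile h h4]
    refine ⟨Finset.disjoint_empty_right _, ?_, fun _ => rfl⟩
    simp only [card_quartileElim, Finset.card_empty]
    omega
  · have hp := hσ.passInvariant (q := q) hR h
    rw [optMAIRound_of_acceptReject h h4]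
    refine ⟨hp.disjoint, ?_, ?_⟩
    · exact hp.le_card.trans (Nat.add_le_add_right (Finset.card_filter_le _ _) _)
    · intro h5
      have := Finset.card_le_card hp.subset
      simp only at h5
      omega

lemma LoopInvariant.exists_feasible {K q : ℕ} {ε : ℝ} {R : Fin n → ℕ → ℝ} {μ : Fin n → ℝ}
    {σ : OptMAIState n} {F : Finset (Fin n)}
    (hσ : LoopInvariant K σ) (hR : ∀ i j, 0 ≤ R i j) (h : σ.IsActive K) (hε : 0 ≤ ε)
    (hF : IsFeasible K σ.remaining σ.accepted F)
    (hgood : IsGoodRound K ε (nextMean q R σ) μ σ.remaining F) :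
    ∃ F', IsFeasible K (optMAIRound K q R σ).remaining (optMAIRound K q R σ).accepted F' ∧
      ∑ i ∈ F, μ i - K * ε ≤ ∑ i ∈ F', μ i := by
  by_cases h4 : 4 * K < σ.remaining.card
  · rw [optMAIRound_of_quartile h h4]
    rw [hσ.accepted_empty h4] at hF
    exact quartileElim_exists_feasible hε h4 hF hgood
  · rw [optMAIRound_of_acceptReject h h4]
    exact acceptReject_exists_feasible h4 (hσ.passInvariant hR h) hF hgood

/-- Both branches leave the same number of arms as long as the loop goes on: accept-reject short of
`K` accepted arms stops exactly when `⌊3|S|/4⌋` arms are left. The sizes and pull blocks of all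
active rounds are thus deterministic, which the independence argument needs. -/
lemma card_remaining_optMAIRound {K q : ℕ} {R : Fin n → ℕ → ℝ} {σ : OptMAIState n}
    (hσ : LoopInvariant K σ) (hR : ∀ i j, 0 ≤ R i j) (h : σ.IsActive K)
    (h' : (optMAIRound K q R σ).IsActive K) :
    (optMAIRound K q R σ).remaining.card = 3 * σ.remaining.card / 4 := by
  by_cases h4 : 4 * K < σ.remaining.card
  · rw [optMAIRound_of_quartile h h4]
    exact card_quartileElim
  · have hp := hσ.passInvariant (q := q) hR h
    rw [optMAIRound_of_acceptReject h h4] at h' ⊢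
    have h1 := card_acceptReject_le h'.1
    have h2 := hp.lower
    simp only
    omega

lemma round_optMAIRound {K q : ℕ} {R : Fin n → ℕ → ℝ} {σ : OptMAIState n} (h : σ.IsActive K) :
    (optMAIRound K q R σ).round = σ.round + 1 ∧ (optMAIRound K q R σ).pulls =
      σ.pulls + roundPulls q σ.round σ.remaining.card := by
  by_cases h4 : 4 * K < σ.remaining.card
  · rw [optMAIRound_of_quartile h h4]
    exact ⟨rfl, rfl⟩
  · rw [optMAIRound_of_acceptReject h h4]
    exact ⟨rfl, rfl⟩

lemma optMAIRound_congr {K q : ℕ} {R R' : Fin n → ℕ → ℝ} {σ : OptMAIState n}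
    (h : σ.IsActive K → nextMean q R σ = nextMean q R' σ) :
    optMAIRound K q R σ = optMAIRound K q R' σ := by
  by_cases ha : σ.IsActive K
  · by_cases h4 : 4 * K < σ.remaining.card
    · rw [optMAIRound_of_quartile ha h4, optMAIRound_of_quartile ha h4, h ha]
    · rw [optMAIRound_of_acceptReject ha h4, optMAIRound_of_acceptReject ha h4, h ha]
  · rw [optMAIRound_of_inactive ha, optMAIRound_of_inactive ha]

end Round

/-! ### The main loop -/

section Loop

variable {n : ℕ}

/-- The number of remaining arms in round `r`, if that round takes place. -/
def armCount (n r : ℕ) : ℕ := (fun N => 3 * N / 4)^[r] n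

lemma armCount_succ (n r : ℕ) : armCount n (r + 1) = 3 * armCount n r / 4 :=
  Function.iterate_succ_apply' _ _ _

lemma armCount_pos_of_le {n i r : ℕ} (hir : i ≤ r) (h : 0 < armCount n r) : 0 < armCount n i := by
  induction hir with
  | refl => exact h
  | step _ ih =>
    rw [armCount_succ] at h
    exact ih (by omega)

/-- The number of pulls of every remaining arm before round `r`. -/
noncomputable def pullCount (n q r : ℕ) : ℕ := ∑ i ∈ Finset.range r, roundPulls q i (armCount n i)

lemma pullCount_succ (n q r : ℕ) :
    pullCount n q (r + 1) = pullCount n q r + roundPulls q r (armCount n r) :=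
  Finset.sum_range_succ _ _

/-- The state after `r` rounds. -/
noncomputable def stateAt (K q : ℕ) (R : Fin n → ℕ → ℝ) (r : ℕ) : OptMAIState n :=
  (optMAIRound K q R)^[r] ⟨Finset.univ, ∅, 0, 0⟩

variable {K q : ℕ} {R : Fin n → ℕ → ℝ}

lemma stateAt_succ (r : ℕ) : stateAt K q R (r + 1) = optMAIRound K q R (stateAt K q R r) :=
  Function.iterate_succ_apply' _ _ _

lemma loopInvariant_stateAt (hK : K ≤ n) (hR : ∀ i j, 0 ≤ R i j) (r : ℕ) :
    LoopInvariant K (stateAt K q R r) := by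
  induction r with
  | zero => exact ⟨Finset.disjoint_empty_right _, by simpa [stateAt] using hK, fun _ => rfl⟩
  | succ r ih =>
    rw [stateAt_succ]
    exact ih.step hR

lemma isActive_stateAt_of_succ {r : ℕ} (h : (stateAt K q R (r + 1)).IsActive K) :
    (stateAt K q R r).IsActive K := by
  by_contra h'
  rw [stateAt_succ, optMAIRound_of_inactive h'] at h
  exact h' h

lemma stateAt_of_isActive (hK : K ≤ n) (hR : ∀ i j, 0 ≤ R i j) {r : ℕ}
    (h : (stateAt K q R r).IsActive K) :
    (stateAt K q R r).remaining.card = armCount n r ∧ (stateAt K q R r).round = r ∧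
      (stateAt K q R r).pulls = pullCount n q r := by
  induction r with
  | zero => simp [stateAt, armCount, pullCount]
  | succ r ih =>
    have h' := isActive_stateAt_of_succ h
    obtain ⟨h1, h2, h3⟩ := ih h'
    rw [stateAt_succ] at h ⊢
    obtain ⟨h4, h5⟩ := round_optMAIRound (q := q) (R := R) h'
    rw [card_remaining_optMAIRound (loopInvariant_stateAt hK hR r) hR h' h, h4, h5, h1, h2, h3,
      armCount_succ, pullCount_succ]
    exact ⟨rfl, rfl, rfl⟩

lemma armCount_pos_of_isActive (hK : K ≤ n) (hR : ∀ i j, 0 ≤ R i j) {r : ℕ}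
    (h : (stateAt K q R r).IsActive K) : 0 < armCount n r := by
  rw [← (stateAt_of_isActive hK hR h).1]
  exact h.2

/-- The pull counter freezes when the loop ends, so it equals `pullCount` at the number `l` of
rounds that really took place. -/
lemma exists_pulls_stateAt (hK : K ≤ n) (hR : ∀ i j, 0 ≤ R i j) (r : ℕ) :
    ∃ l, (stateAt K q R r).pulls = pullCount n q l ∧ ∀ i < l, 0 < armCount n i := by
  induction r with
  | zero => exact ⟨0, by simp [stateAt, pullCount], by simp⟩
  | succ r ih =>
    by_cases h : (stateAt K q R r).IsActive K
    · refine ⟨r + 1, ?_, ?_⟩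
      · obtain ⟨h1, h2, h3⟩ := stateAt_of_isActive hK hR h
        rw [stateAt_succ, (round_optMAIRound h).2, pullCount_succ, h1, h2, h3]
      · exact fun i hi =>
          armCount_pos_of_le (Nat.lt_succ_iff.mp hi) (armCount_pos_of_isActive hK hR h)
    · rw [stateAt_succ, optMAIRound_of_inactive h]
      exact ih

lemma not_isActive_stateAt_self (hK : K ≤ n) (hR : ∀ i j, 0 ≤ R i j) :
    ¬ (stateAt K q R n).IsActive K := by
  intro h
  have h1 := armCount_pos_of_isActive hK hR h
  have h2 : ∀ r, armCount n r + r ≤ n ∨ armCount n r = 0 := by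
    intro r
    induction r with
    | zero => left; exact le_rfl
    | succ r ih =>
      rw [armCount_succ]
      omega
  have := h2 n
  omega

/-- The state before round `r` reads only earlier pulls; this makes it independent of the rewards of
round `r`. -/
lemma stateAt_congr (hK : K ≤ n) {R' : Fin n → ℕ → ℝ} (hR : ∀ i j, 0 ≤ R i j) (r : ℕ)
    (h : ∀ i, ∀ j < pullCount n q r, R i j = R' i j) :
    stateAt K q R r = stateAt K q R' r := by
  induction r with
  | zero => simp only [stateAt, Function.iterate_zero, id]
  | succ r ih =>
    rw [pullCount_succ] at h
    have ih' := ih fun i j hj => h i j (by omega)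
    rw [stateAt_succ, stateAt_succ, ← ih']
    refine optMAIRound_congr fun ha => ?_
    obtain ⟨h1, h2, h3⟩ := stateAt_of_isActive hK hR ha
    funext i
    unfold nextMean empMean
    rw [h1, h2, h3]
    congr 1
    refine Finset.sum_congr rfl fun j hj => h i j (Finset.mem_Ico.mp hj).2

/-- Once the loop has stopped, the constraints on a feasible set leave only one candidate. -/
lemma isFeasible_of_not_isActive {σ : OptMAIState n} {F : Finset (Fin n)}
    (hF : IsFeasible K σ.remaining σ.accepted F) (h : ¬ σ.IsActive K) : F = σ.accepted := by
  obtain ⟨h1, h2, h3⟩ := hF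
  by_cases hc : σ.accepted.card < K
  · have : σ.remaining = ∅ := by
      by_contra h0
      exact h ⟨hc, Finset.card_pos.mpr (Finset.nonempty_iff_ne_empty.mpr h0)⟩
    rw [this, Finset.empty_union] at h2
    exact h2.antisymm h1
  · exact (Finset.eq_of_subset_of_card_le h1 (by omega)).symm

/-- A feasible set with the largest sum of means (`∅` if there is no feasible set). -/
noncomputable def bestFeasible (K : ℕ) (μ : Fin n → ℝ) (S T : Finset (Fin n)) : Finset (Fin n) := by
  classical
  exact if h : ∃ F, IsFeasible K S T F ∧ ∀ F', IsFeasible K S T F' → ∑ i ∈ F', μ i ≤ ∑ i ∈ F, μ i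
    then h.choose else ∅

lemma bestFeasible_spec {μ : Fin n → ℝ} {S T F : Finset (Fin n)} (hF : IsFeasible K S T F) :
    IsFeasible K S T (bestFeasible K μ S T) ∧ ∑ i ∈ F, μ i ≤ ∑ i ∈ bestFeasible K μ S T, μ i := by
  classical
  have h : ∃ F, IsFeasible K S T F ∧ ∀ F', IsFeasible K S T F' → ∑ i ∈ F', μ i ≤ ∑ i ∈ F, μ i := by
    obtain ⟨G, hG, hmax⟩ := (Finset.univ.filter (IsFeasible K S T)).exists_max_image
      (fun F => ∑ i ∈ F, μ i) ⟨F, by simpa using hF⟩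
    refine ⟨G, by simpa using hG, fun F' hF' => hmax F' (by simpa using hF')⟩
  unfold bestFeasible
  rw [dif_pos h]
  exact ⟨h.choose_spec.1, h.choose_spec.2 F hF⟩

/-- The means of round `r` are accurate in the state after `r` rounds, if that round takes place. -/
def IsGoodAt (K q : ℕ) (R : Fin n → ℕ → ℝ) (μ : Fin n → ℝ) (ε : ℕ → ℝ) (r : ℕ) : Prop :=
  (stateAt K q R r).IsActive K →
    IsGoodRound K (ε r) (empMean R (pullCount n q r) (roundPulls q r (armCount n r))) μ
      (stateAt K q R r).remaining
      (bestFeasible K μ (stateAt K q R r).remaining (stateAt K q R r).accepted)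

/-- In each round the set from the induction is replaced by `bestFeasible`, which is no worse and
depends on the state alone. So accuracy is only required for a set fixed before the rewards of the
round are drawn. -/
lemma exists_feasible_stateAt (hK : K ≤ n) (hR : ∀ i j, 0 ≤ R i j) {μ : Fin n → ℝ} {ε : ℕ → ℝ}
    (hε : ∀ r, 0 ≤ ε r) {F : Finset (Fin n)} (hF : F.card = K) (r : ℕ)
    (hgood : ∀ i < r, IsGoodAt K q R μ ε i) :
    ∃ F', IsFeasible K (stateAt K q R r).remaining (stateAt K q R r).accepted F' ∧
      ∑ i ∈ F, μ i - K * ∑ i ∈ Finset.range r, ε i ≤ ∑ i ∈ F', μ i := by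
  induction r with
  | zero =>
    refine ⟨F, ⟨Finset.empty_subset _, ?_, hF⟩, by simp⟩
    simp [stateAt]
  | succ r ih =>
    obtain ⟨F', h1, h2⟩ := ih fun i hi => hgood i (by omega)
    rw [stateAt_succ, Finset.sum_range_succ, mul_add]
    by_cases ha : (stateAt K q R r).IsActive K
    · obtain ⟨h3, h4⟩ := bestFeasible_spec (μ := μ) h1
      have hg := hgood r (by omega) ha
      obtain ⟨e1, e2, e3⟩ := stateAt_of_isActive hK hR ha
      obtain ⟨F'', h5, h6⟩ := (loopInvariant_stateAt hK hR r).exists_feasible (q := q) hR ha (hε r)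
        h3 (by unfold nextMean; rw [e1, e2, e3]; exact hg)
      exact ⟨F'', h5, by linarith⟩
    · rw [optMAIRound_of_inactive ha]
      have : 0 ≤ (K : ℝ) * ε r := mul_nonneg (Nat.cast_nonneg K) (hε r)
      exact ⟨F', h1, by linarith⟩

lemma bestAvgError_mem (η : Fin n → ℝ) (hK : K ≤ n) :
    ∃ S : Finset (Fin n), S.card = K ∧ bestAvgError η K = avgError η S := by
  have hne : {x : ℝ | ∃ S : Finset (Fin n), S.card = K ∧ x = avgError η S}.Nonempty := by
    obtain ⟨S, -, hS⟩ := Finset.exists_subset_card_eq (s := (Finset.univ : Finset (Fin n))) (n := K)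
      (by simpa using hK)
    exact ⟨_, S, hS, rfl⟩
  have hfin : {x : ℝ | ∃ S : Finset (Fin n), S.card = K ∧ x = avgError η S}.Finite := by
    apply (Set.finite_range (fun S : Finset (Fin n) => avgError η S)).subset
    rintro x ⟨S, -, rfl⟩
    exact ⟨S, rfl⟩
  exact hne.csInf_mem hfin

/-- If the empirical means of all rounds are accurate, the output is optimal up to the sum of the
accuracies. -/
lemma isDeltaOptimal_optMAI (hK0 : 1 ≤ K) (hK : K ≤ n) (hR : ∀ i j, 0 ≤ R i j) {η : Fin n → ℝ}
    {ε : ℕ → ℝ} (hε : ∀ r, 0 ≤ ε r) {Δ : ℝ} (hΔ : ∑ i ∈ Finset.range n, ε i ≤ Δ)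
    (hgood : ∀ i < n, IsGoodAt K q R (fun i => 1 - η i) ε i) :
    IsDeltaOptimal η K Δ (optMAI K q R).accepted := by
  obtain ⟨S, hS, hSopt⟩ := bestAvgError_mem η hK
  obtain ⟨F, hF, hle⟩ := exists_feasible_stateAt hK hR hε hS n hgood
  have hFacc := isFeasible_of_not_isActive hF (not_isActive_stateAt_self hK hR)
  have hc := hF.2.2
  rw [hFacc] at hle hc
  have hacc : (optMAI K q R).accepted = (stateAt K q R n).accepted := rfl
  rw [← hacc] at hle hc
  refine ⟨hc, ?_⟩
  rw [hSopt, avgError, avgError, hc, hS, div_add' _ _ _ (by positivity)]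
  gcongr
  rw [Finset.sum_sub_distrib, Finset.sum_sub_distrib, Finset.sum_const, Finset.sum_const, hc, hS]
    at hle
  have : (K : ℝ) * ∑ i ∈ Finset.range n, ε i ≤ K * Δ := by gcongr
  linarith

end Loop

/-! ### The number of pulls -/

section Pulls

lemma exp_two_tenths_le : Real.exp 0.2 ≤ 5 / 4 := by
  have h := Real.one_sub_le_exp_neg (0.2 : ℝ)
  rw [Real.exp_neg] at h
  have h2 : (4 / 5 : ℝ) ≤ (Real.exp 0.2)⁻¹ := by linarith
  have h3 := inv_anti₀ (by norm_num) h2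
  rw [inv_inv] at h3
  linarith

lemma le_exp_two_tenths : 6 / 5 ≤ Real.exp 0.2 := by
  have h := Real.add_one_le_exp (0.2 : ℝ)
  linarith

lemma optMAIRate_pos : 0 < optMAIRate := by
  unfold optMAIRate
  positivity

lemma one_sub_optMAIRate_ge : 1 / 16 ≤ 1 - optMAIRate := by
  unfold optMAIRate
  linarith [exp_two_tenths_le]

lemma optMAIRate_pow (r : ℕ) : optMAIRate ^ r = (3 / 4) ^ r * Real.exp 0.2 ^ r := by
  unfold optMAIRate
  rw [← mul_pow]
  norm_num

/-- Rounding loses at most 3/4 per round, and `3` is the resulting geometric sum. When an arm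
remains, `armCount + 3 ≤ 4 * armCount`, so rounding costs a factor of at most 4. -/
lemma le_armCount_add (n r : ℕ) : (3 / 4 : ℝ) ^ r * n ≤ armCount n r + 3 := by
  induction r with
  | zero => simp [armCount]
  | succ r ih =>
    have h : 3 * armCount n r ≤ 4 * armCount n (r + 1) + 3 := by
      rw [armCount_succ]
      omega
    have h' : (3 : ℝ) * armCount n r ≤ 4 * armCount n (r + 1) + 3 := by exact_mod_cast h
    rw [pow_succ]
    linarith

lemma armCount_le (n r : ℕ) : (armCount n r : ℝ) ≤ (3 / 4 : ℝ) ^ r * n := by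
  induction r with
  | zero => simp [armCount]
  | succ r ih =>
    have h : 4 * armCount n (r + 1) ≤ 3 * armCount n r := by
      rw [armCount_succ]
      omega
    have h' : (4 : ℝ) * armCount n (r + 1) ≤ 3 * armCount n r := by exact_mod_cast h
    rw [pow_succ]
    linarith

/-- A remaining arm forces `(4/3)^r ≤ n`, and `exp 0.2 = exp (2/7) ^ 0.7` with `exp (2/7) ≤ 4/3`;
this is the source of the exponent 0.7. -/
lemma exp_two_tenths_pow_le {n r : ℕ} (h : 0 < armCount n r) :
    Real.exp 0.2 ^ r ≤ (n : ℝ) ^ (0.7 : ℝ) := by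
  have h1 : (1 : ℝ) ≤ (3 / 4 : ℝ) ^ r * n :=
    le_trans (by exact_mod_cast h) (armCount_le n r)
  have hn : (4 / 3 : ℝ) ^ r ≤ n := by
    have h2 : (4 / 3 : ℝ) ^ r * ((3 / 4 : ℝ) ^ r * n) = n := by
      rw [← mul_assoc, ← mul_pow]
      norm_num
    calc (4 / 3 : ℝ) ^ r = (4 / 3 : ℝ) ^ r * 1 := (mul_one _).symm
      _ ≤ (4 / 3 : ℝ) ^ r * ((3 / 4 : ℝ) ^ r * n) := by gcongr
      _ = n := h2
  -- Raised to the seventh power, this is `e² ≤ (4/3)^7`.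
  have hlog : Real.exp (2 / 7) ≤ 4 / 3 := by
    rw [← pow_le_pow_iff_left₀ (Real.exp_pos _).le (by norm_num) (n := 7) (by norm_num),
      ← Real.exp_nat_mul]
    have h3 : Real.exp (((7 : ℕ) : ℝ) * (2 / 7)) = Real.exp 1 ^ 2 := by
      rw [← Real.exp_nat_mul]
      norm_num
    rw [h3]
    calc Real.exp 1 ^ 2 ≤ 2.7182818286 ^ 2 := by
          gcongr
          exact Real.exp_one_lt_d9.le
      _ ≤ _ := by norm_num
  calc Real.exp 0.2 ^ r = (Real.exp (2 / 7) ^ r) ^ (0.7 : ℝ) := by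
        rw [← Real.exp_nat_mul, ← Real.exp_nat_mul, ← Real.exp_mul]
        congr 1
        ring
    _ ≤ ((4 / 3 : ℝ) ^ r) ^ (0.7 : ℝ) := by gcongr
    _ ≤ _ := by gcongr

lemma roundPulls_le {n q r : ℕ} (h : 0 < armCount n r) :
    (roundPulls q r (armCount n r) : ℝ) ≤ 4 * q / n * Real.exp 0.2 ^ r := by
  have hn : (0 : ℝ) < n := by
    have h1 := (armCount_le n r)
    have h2 : (0 : ℝ) < armCount n r := by exact_mod_cast h
    by_contra! h3
    have : (3 / 4 : ℝ) ^ r * n ≤ 0 := mul_nonpos_of_nonneg_of_nonpos (by positivity) h3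
    linarith
  have hN : (1 : ℝ) ≤ armCount n r := by exact_mod_cast h
  have h4 : (3 / 4 : ℝ) ^ r * n ≤ 4 * armCount n r := by linarith [le_armCount_add n r]
  have hβ := optMAIRate_pos
  have hβ' := one_sub_optMAIRate_ge
  unfold roundPulls
  calc ((⌊optMAIRate ^ r * (1 - optMAIRate) * (q : ℝ) / (armCount n r : ℝ)⌋₊ : ℕ) : ℝ)
      ≤ optMAIRate ^ r * (1 - optMAIRate) * (q : ℝ) / (armCount n r : ℝ) :=
        Nat.floor_le (by positivity)
    _ ≤ optMAIRate ^ r * 1 * (q : ℝ) / (armCount n r : ℝ) := by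
        gcongr
        linarith
    _ ≤ _ := by
        rw [optMAIRate_pow, div_mul_eq_mul_div, div_le_div_iff₀ (by linarith) hn]
        have : 0 ≤ (q : ℝ) * Real.exp 0.2 ^ r := by positivity
        nlinarith

lemma pullCount_le {n q l : ℕ} (h : ∀ i < l, 0 < armCount n i) :
    (pullCount n q l : ℝ) ≤ 25 * (q / (n : ℝ) ^ (0.3 : ℝ)) := by
  rcases l with _ | l
  · simp only [pullCount, Finset.range_zero, Finset.sum_empty, Nat.cast_zero]
    positivity
  have hl := exp_two_tenths_pow_le (h l (by omega))
  have hn : (0 : ℝ) < n := by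
    have : 0 < armCount n 0 := h 0 (by omega)
    exact_mod_cast this
  -- The last term dominates the geometric sum; the ratio lies between 6/5 and 5/4, whence the
  -- constant `5 * (5/4)`.
  have hg : ∑ i ∈ Finset.range (l + 1), Real.exp 0.2 ^ i ≤ 25 / 4 * (n : ℝ) ^ (0.7 : ℝ) := by
    have h1 := mul_geom_sum (Real.exp 0.2) (l + 1)
    have h2 : 0 ≤ ∑ i ∈ Finset.range (l + 1), Real.exp 0.2 ^ i :=
      Finset.sum_nonneg fun i _ => by positivity
    have h3 : Real.exp 0.2 ^ (l + 1) ≤ 5 / 4 * (n : ℝ) ^ (0.7 : ℝ) := by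
      rw [pow_succ, mul_comm]
      exact mul_le_mul exp_two_tenths_le hl (by positivity) (by norm_num)
    nlinarith [le_exp_two_tenths]
  have hpow : (n : ℝ) ^ (0.7 : ℝ) / n = 1 / (n : ℝ) ^ (0.3 : ℝ) := by
    rw [div_eq_div_iff hn.ne' (by positivity), one_mul, ← Real.rpow_add hn]
    norm_num
  calc (pullCount n q (l + 1) : ℝ)
      = ∑ i ∈ Finset.range (l + 1), (roundPulls q i (armCount n i) : ℝ) := by
        unfold pullCount
        push_cast
        rfl
    _ ≤ ∑ i ∈ Finset.range (l + 1), 4 * q / n * Real.exp 0.2 ^ i :=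
        Finset.sum_le_sum fun i hi => roundPulls_le (h i (Finset.mem_range.mp hi))
    _ = 4 * q / n * ∑ i ∈ Finset.range (l + 1), Real.exp 0.2 ^ i := by rw [Finset.mul_sum]
    _ ≤ 4 * q / n * (25 / 4 * (n : ℝ) ^ (0.7 : ℝ)) := by gcongr
    _ = 25 * q * ((n : ℝ) ^ (0.7 : ℝ) / n) := by ring
    _ = _ := by rw [hpow]; ring

lemma le_roundPulls {n q r : ℕ} (h : 0 < armCount n r) (hn : 0 < n) (hq : 16 * (n : ℝ) ≤ q) :
    (6 / 5 : ℝ) ^ r * q / (32 * n) ≤ roundPulls q r (armCount n r) := by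
  have hn' : (0 : ℝ) < n := by exact_mod_cast hn
  have hN : (0 : ℝ) < armCount n r := by exact_mod_cast h
  have hβ := optMAIRate_pos
  have hβ' := one_sub_optMAIRate_ge
  have hy : (6 / 5 : ℝ) ^ r * q / (16 * n) ≤
      optMAIRate ^ r * (1 - optMAIRate) * (q : ℝ) / (armCount n r : ℝ) := by
    calc (6 / 5 : ℝ) ^ r * q / (16 * n)
        = (3 / 4) ^ r * (6 / 5 : ℝ) ^ r * (1 / 16) * q / ((3 / 4) ^ r * n) := by
          field_simp
      _ ≤ (3 / 4) ^ r * Real.exp 0.2 ^ r * (1 - optMAIRate) * q / (armCount n r) := by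
          have := le_exp_two_tenths
          have := armCount_le n r
          gcongr
      _ = _ := by rw [optMAIRate_pow]
  -- The quantity under the floor is at least 1, so rounding down costs at most a factor 2: 16
  -- becomes 32.
  have h1 : (1 : ℝ) ≤ (6 / 5 : ℝ) ^ r * q / (16 * n) := by
    rw [le_div_iff₀ (by positivity), one_mul]
    calc 16 * (n : ℝ) ≤ 1 * q := by linarith
      _ ≤ _ := by
        gcongr
        exact one_le_pow₀ (by norm_num)
  unfold roundPulls
  have h2 := Nat.lt_floor_add_one (optMAIRate ^ r * (1 - optMAIRate) * (q : ℝ) / (armCount n r : ℝ))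
  have h3 : 1 ≤ ⌊optMAIRate ^ r * (1 - optMAIRate) * (q : ℝ) / (armCount n r : ℝ)⌋₊ :=
    Nat.le_floor (by push_cast; linarith)
  have h3' : (1 : ℝ) ≤ ⌊optMAIRate ^ r * (1 - optMAIRate) * (q : ℝ) / (armCount n r : ℝ)⌋₊ := by
    exact_mod_cast h3
  have h4 : (6 / 5 : ℝ) ^ r * q / (32 * n) = (6 / 5 : ℝ) ^ r * q / (16 * n) / 2 := by
    rw [div_div]
    ring_nf
  rw [h4]
  linarith

end Pulls

/-! ### Concentration of the empirical means -/

/-- The reward table that is given by finitely many boolean rewards. -/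
def rewardTable {n s : ℕ} (f : Fin n × Fin s → Bool) (i : Fin n) (j : ℕ) : ℝ :=
  if h : j < s then (if f (i, ⟨j, h⟩) = true then 1 else 0) else 0

lemma rewardTable_nonneg {n s : ℕ} (f : Fin n × Fin s → Bool) (i : Fin n) (j : ℕ) :
    0 ≤ rewardTable f i j := by
  unfold rewardTable
  split_ifs <;> norm_num

/-- The indices of the pulls number `a, …, a + t - 1`. -/
def pullBlock (s a t : ℕ) : Finset (Fin s) := Finset.univ.filter (fun j => a ≤ j.1 ∧ j.1 < a + t)

lemma map_pullBlock {s a t : ℕ} (h : a + t ≤ s) :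
    (pullBlock s a t).map Fin.valEmbedding = Finset.Ico a (a + t) := by
  ext j
  simp only [pullBlock, Finset.mem_map, Finset.mem_filter, Finset.mem_univ, true_and,
    Fin.valEmbedding_apply, Finset.mem_Ico]
  constructor
  · rintro ⟨x, hx, rfl⟩
    exact hx
  · intro hj
    exact ⟨⟨j, by omega⟩, hj, rfl⟩

lemma card_pullBlock {s a t : ℕ} (h : a + t ≤ s) : (pullBlock s a t).card = t := by
  rw [← Finset.card_map Fin.valEmbedding, map_pullBlock h, Nat.card_Ico]
  omega

lemma empMean_rewardTable {n s a t : ℕ} (h : a + t ≤ s) (f : Fin n × Fin s → Bool) (i : Fin n) :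
    empMean (rewardTable f) a t i =
      (∑ j ∈ pullBlock s a t, if f (i, j) = true then (1 : ℝ) else 0) / t := by
  unfold empMean
  rw [← map_pullBlock h, Finset.sum_map]
  congr 1
  refine Finset.sum_congr rfl fun j _ => ?_
  simp [rewardTable]

/-- The deviation of a boolean reward from its mean. -/
noncomputable def rewardDeviation {n s : ℕ} {Ω : Type*} (μ : Fin n → ℝ) (b : Fin n × Fin s → Ω → Bool)
    (p : Fin n × Fin s) (ω : Ω) : ℝ :=
  (if b p ω = true then (1 : ℝ) else 0) - μ p.1

lemma sum_rewardDeviation {n s : ℕ} {Ω : Type*} {b : Fin n × Fin s → Ω → Bool} {μ : Fin n → ℝ} {a t : ℕ}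
    (h : a + t ≤ s) (ht : 0 < t) (D : Finset (Fin n)) (ω : Ω) :
    ∑ p ∈ D ×ˢ pullBlock s a t, rewardDeviation μ b p ω =
      t * ∑ i ∈ D, (empMean (rewardTable fun p => b p ω) a t i - μ i) := by
  have ht' : (t : ℝ) ≠ 0 := by exact_mod_cast ht.ne'
  rw [Finset.sum_product, Finset.mul_sum]
  refine Finset.sum_congr rfl fun i _ => ?_
  simp only [rewardDeviation, Finset.sum_sub_distrib, Finset.sum_const, card_pullBlock h,
    nsmul_eq_mul]
  rw [empMean_rewardTable h, mul_sub, mul_div_cancel₀ _ ht']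

lemma iIndepFun_rewardDeviation {n s : ℕ} {Ω : Type*} [MeasurableSpace Ω] {P : Measure Ω}
    {b : Fin n × Fin s → Ω → Bool} (hind : iIndepFun b P) (μ : Fin n → ℝ) :
    iIndepFun (rewardDeviation μ b) P :=
  hind.comp (fun p x => (if x = true then (1 : ℝ) else 0) - μ p.1)
    fun _ => measurable_of_finite _

lemma hoeffding_exponent {N t u : ℝ} (hN : 0 ≤ N) (ht : 0 < t) :
    -(t * u) ^ 2 / (2 * (N * t * (1 / 4))) = -(2 * t * u ^ 2 / N) := by
  rcases hN.eq_or_lt with rfl | hN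
  · simp
  · field_simp
    ring

lemma sum_subgaussian_constant {n s a t : ℕ} (h : a + t ≤ s) (D : Finset (Fin n)) :
    ((∑ _p ∈ D ×ˢ pullBlock s a t, (1 / 4 : NNReal) : NNReal) : ℝ) = D.card * t * (1 / 4) := by
  rw [Finset.sum_const, Finset.card_product, card_pullBlock h]
  push_cast
  rw [nsmul_eq_mul]
  push_cast
  ring

section Concentration

variable {n s : ℕ} {Ω : Type*} [MeasurableSpace Ω] {P : Measure Ω} [IsProbabilityMeasure P]
  {b : Fin n × Fin s → Ω → Bool} {η : Fin n → ℝ}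

lemma hasSubgaussianMGF_rewardDeviation (hb : ∀ p, Measurable (b p))
    (hη : ∀ p, P.real {ω | b p ω = false} = η p.1) (p : Fin n × Fin s) :
    HasSubgaussianMGF (rewardDeviation (fun i => 1 - η i) b p) (1 / 4) P := by
  have hm : Measurable (fun ω => if b p ω = true then (1 : ℝ) else 0) :=
    (measurable_of_finite (fun x : Bool => if x = true then (1 : ℝ) else 0)).comp (hb p)
  have hmean : ∫ ω, (if b p ω = true then (1 : ℝ) else 0) ∂P = 1 - η p.1 := by
    have h1 : MeasurableSet {ω | b p ω = false} := hb p (measurableSet_singleton false)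
    have h2 : (fun ω => if b p ω = true then (1 : ℝ) else 0) =
        {ω | b p ω = false}ᶜ.indicator 1 := by
      funext ω
      by_cases h : b p ω = true <;> simp [Set.indicator, h]
    rw [h2, integral_indicator_one h1.compl, probReal_compl_eq_one_sub h1, hη]
  have := hasSubgaussianMGF_of_mem_Icc (μ := P) (a := 0) (b := 1) hm.aemeasurable
    (Filter.Eventually.of_forall fun ω => by
      by_cases h : b p ω = true <;> simp [h])
  have hc : (‖(1 : ℝ) - 0‖₊ / 2) ^ 2 = 1 / 4 := by
    rw [sub_zero, nnnorm_one, div_pow]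
    norm_num
  rw [hmean, hc] at this
  exact this

/-- Hoeffding's inequality for the `|D| * t` independent rewards pooled over arms and pulls. Only
sums over sets of arms are needed, not the accuracy of every single arm. -/
lemma measure_le_sum_deviation (hb : ∀ p, Measurable (b p)) (hind : iIndepFun b P)
    (hη : ∀ p, P.real {ω | b p ω = false} = η p.1) {a t : ℕ} (h : a + t ≤ s) (ht : 0 < t)
    (D : Finset (Fin n)) {u : ℝ} (hu : 0 ≤ u) :
    P.real {ω | u ≤ ∑ i ∈ D, (empMean (rewardTable fun p => b p ω) a t i - (1 - η i))} ≤
      Real.exp (-(2 * t * u ^ 2 / D.card)) := by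
  have ht' : (0 : ℝ) < t := by exact_mod_cast ht
  have h1 := HasSubgaussianMGF.measure_sum_ge_le_of_iIndepFun
    (iIndepFun_rewardDeviation hind fun i => 1 - η i) (s := D ×ˢ pullBlock s a t)
    (fun p _ => hasSubgaussianMGF_rewardDeviation hb hη p) (ε := t * u) (by positivity)
  rw [sum_subgaussian_constant h, hoeffding_exponent (Nat.cast_nonneg _) ht'] at h1
  convert h1 using 4 with ω
  rw [sum_rewardDeviation h ht]
  exact (mul_le_mul_iff_right₀ ht').symm

lemma measure_le_sum_neg_deviation (hb : ∀ p, Measurable (b p)) (hind : iIndepFun b P)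
    (hη : ∀ p, P.real {ω | b p ω = false} = η p.1) {a t : ℕ} (h : a + t ≤ s) (ht : 0 < t)
    (D : Finset (Fin n)) {u : ℝ} (hu : 0 ≤ u) :
    P.real {ω | u ≤ ∑ i ∈ D, ((1 - η i) - empMean (rewardTable fun p => b p ω) a t i)} ≤
      Real.exp (-(2 * t * u ^ 2 / D.card)) := by
  have ht' : (0 : ℝ) < t := by exact_mod_cast ht
  have h1 := HasSubgaussianMGF.measure_sum_ge_le_of_iIndepFun
    (X := fun p ω => -rewardDeviation (fun i => 1 - η i) b p ω)
    ((iIndepFun_rewardDeviation hind fun i => 1 - η i).comp (fun _ x => -x)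
      fun _ => measurable_neg) (s := D ×ˢ pullBlock s a t)
    (fun p _ => (hasSubgaussianMGF_rewardDeviation hb hη p).neg) (ε := t * u) (by positivity)
  rw [sum_subgaussian_constant h, hoeffding_exponent (Nat.cast_nonneg _) ht'] at h1
  convert h1 using 4 with ω
  rw [Finset.sum_neg_distrib, sum_rewardDeviation h ht, ← mul_neg, ← Finset.sum_neg_distrib]
  simp only [neg_sub]
  exact (mul_le_mul_iff_right₀ ht').symm

end Concentration

/-! ### The probability of an inaccurate round -/

/-- There are `2^|S| ≤ e^N` subsets, and the extra `N` in the exponent pays for them. -/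
lemma measure_exists_subset_le {n : ℕ} {Ω : Type*} [MeasurableSpace Ω] {P : Measure Ω}
    (S : Finset (Fin n)) (E : Finset (Fin n) → Ω → Prop) {N z : ℝ}
    (hN : (S.card : ℝ) ≤ N) (h : ∀ A ⊆ S, P.real {ω | E A ω} ≤ Real.exp (-(N + z))) :
    P.real {ω | ∃ A ⊆ S, E A ω} ≤ Real.exp (-z) := by
  have h1 : {ω | ∃ A ⊆ S, E A ω} = ⋃ A ∈ S.powerset, {ω | E A ω} := by
    ext ω
    simp
  rw [h1]
  calc P.real (⋃ A ∈ S.powerset, {ω | E A ω}) ≤ ∑ A ∈ S.powerset, P.real {ω | E A ω} :=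
        measureReal_biUnion_finset_le _ _
    _ ≤ ∑ A ∈ S.powerset, Real.exp (-(N + z)) :=
        Finset.sum_le_sum fun A hA => h A (Finset.mem_powerset.mp hA)
    _ = 2 ^ S.card * Real.exp (-(N + z)) := by
        rw [Finset.sum_const, Finset.card_powerset, nsmul_eq_mul]
        push_cast
        rfl
    _ ≤ Real.exp N * Real.exp (-(N + z)) := by
        gcongr
        calc (2 : ℝ) ^ S.card ≤ Real.exp 1 ^ S.card := by
              gcongr
              linarith [Real.add_one_le_exp (1 : ℝ)]
          _ = Real.exp S.card := by rw [← Real.exp_nat_mul, mul_one]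
          _ ≤ Real.exp N := Real.exp_le_exp.mpr hN
    _ = Real.exp (-z) := by
        rw [← Real.exp_add]
        congr 1
        ring

section BadRound

variable {n : ℕ} {Ω : Type*} [MeasurableSpace Ω] {P : Measure Ω}

lemma measure_exists_deviation_le {N z : ℝ} {S : Finset (Fin n)}
    {c : Finset (Fin n) → ℝ} (θ : Ω → Fin n → ℝ) (Q : Finset (Fin n) → Prop)
    {t : ℕ} (hN : (S.card : ℝ) ≤ N)
    (hpos : ∀ A ⊆ S, Q A → 0 < c A)
    (hdev : ∀ A ⊆ S, Q A →
      P.real {ω | c A ≤ ∑ i ∈ A, θ ω i} ≤ Real.exp (-(2 * t * c A ^ 2 / A.card)))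
    (hexp : ∀ A ⊆ S, Q A → (0 : ℝ) < A.card → (N + z) * A.card ≤ 2 * t * c A ^ 2) :
    P.real {ω | ∃ A ⊆ S, Q A ∧ c A ≤ ∑ i ∈ A, θ ω i} ≤ Real.exp (-z) := by
  refine measure_exists_subset_le S _ hN fun A hA => ?_
  by_cases hQ : Q A
  swap
  · simp only [hQ, false_and, Set.ofPred_false, measureReal_empty]
    positivity
  rcases A.eq_empty_or_nonempty with rfl | hne
  · have : ¬ c ∅ ≤ 0 := not_le.mpr (hpos _ hA hQ)
    simp only [Finset.sum_empty, this, and_false, Set.ofPred_false, measureReal_empty]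
    positivity
  · have hc : (0 : ℝ) < A.card := by exact_mod_cast hne.card_pos
    simp only [hQ, true_and]
    refine (hdev A hA hQ).trans (Real.exp_le_exp.mpr (neg_le_neg ?_))
    rw [le_div_iff₀ hc]
    exact hexp A hA hQ hc

variable [IsProbabilityMeasure P] {s : ℕ} {b : Fin n × Fin s → Ω → Bool} {η : Fin n → ℝ}

/-- With many arms, a union over all subsets of `S` is affordable only because the relevant `D` have
at least `|S|/4` elements and an allowance proportional to `|D|`; underestimation matters only
inside `F`, which has at most `2^K` subsets. With at most `4K` arms all subsets of `S` are
affordable. -/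
lemma measure_not_isGoodRound_le (hb : ∀ p, Measurable (b p)) (hind : iIndepFun b P)
    (hη : ∀ p, P.real {ω | b p ω = false} = η p.1) {a t : ℕ} (h : a + t ≤ s) (ht : 0 < t)
    {K : ℕ} (hK : 1 ≤ K) {ε : ℝ} (hε : 0 < ε) (hx : 64 ≤ t * ε ^ 2) (S F : Finset (Fin n))
    (hF : F.card ≤ K) :
    P.real {ω | ¬ IsGoodRound K ε (empMean (rewardTable fun p => b p ω) a t)
      (fun i => 1 - η i) S F} ≤ 2 * Real.exp (-(t * ε ^ 2 * K / 16)) := by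
  have hK' : (1 : ℝ) ≤ K := by exact_mod_cast hK
  set x : ℝ := t * ε ^ 2 with hxdef
  have hc : (0 : ℝ) < K * ε / 2 := by positivity
  have key : ∀ B : Ω → Prop, ∀ C : Ω → Prop, ∀ y : ℝ, P.real {ω | B ω} ≤ y → P.real {ω | C ω} ≤ y →
      P.real {ω | B ω ∨ C ω} ≤ 2 * y := by
    intro B C y hB hC
    rw [Set.ofPred_or]
    linarith [measureReal_union_le (μ := P) {ω | B ω} {ω | C ω}]
  by_cases h4 : 4 * K < S.card
  · have h4' : (4 : ℝ) * K ≤ S.card := by exact_mod_cast h4.le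
    refine le_trans (measureReal_mono ?_ (by finiteness)) (key
      (fun ω => ∃ A ⊆ F, True ∧ (fun _ => K * ε / 2) A ≤
        ∑ i ∈ A, ((1 - η i) - empMean (rewardTable fun p => b p ω) a t i))
      (fun ω => ∃ D ⊆ S, S.card ≤ 4 * D.card ∧ (fun D : Finset (Fin n) => D.card * ε / 2) D ≤
        ∑ i ∈ D, (empMean (rewardTable fun p => b p ω) a t i - (1 - η i))) _
      (measure_exists_deviation_le (t := t) (N := K) _ _ (by exact_mod_cast hF) ?_ ?_ ?_)
      (measure_exists_deviation_le (t := t) (N := S.card) _ _ le_rfl ?_ ?_ ?_))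
    · intro ω hω
      simp only [Set.mem_ofPred_eq, IsGoodRound, if_pos h4] at hω ⊢
      by_contra! hcon
      exact hω ⟨fun A hA => hcon.1 A hA trivial, fun D hD hD' => hcon.2 D hD hD'⟩
    · exact fun _ _ _ => hc
    · exact fun A _ _ => measure_le_sum_neg_deviation hb hind hη h ht A hc.le
    · intro A hA _ _
      have h1 : (A.card : ℝ) ≤ K := by exact_mod_cast (Finset.card_le_card hA).trans hF
      calc (K + x * K / 16) * A.card ≤ (K + x * K / 16) * K := by gcongr
        _ ≤ x * K * K / 2 := by nlinarith [mul_self_nonneg (K : ℝ)]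
        _ = 2 * t * (K * ε / 2) ^ 2 := by rw [hxdef]; ring
    · intro D _ hD
      have : 0 < D.card := by omega
      positivity
    · exact fun D _ _ => measure_le_sum_deviation hb hind hη h ht D (by positivity)
    · intro D _ hD _
      have h1 : (S.card : ℝ) ≤ 4 * D.card := by exact_mod_cast hD
      -- Here `K ≤ |D|`, because `4K < |S| ≤ 4|D|`.
      calc (S.card + x * K / 16) * D.card ≤ (4 * D.card + x * D.card / 16) * D.card := by
            gcongr
            linarith
        _ ≤ x * D.card * D.card / 2 := by nlinarith [mul_self_nonneg (D.card : ℝ)]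
        _ = 2 * t * (D.card * ε / 2) ^ 2 := by rw [hxdef]; ring
  · have h4' : (S.card : ℝ) ≤ 4 * K := by exact_mod_cast not_lt.mp h4
    have hexp : ∀ A ⊆ S, True → (0 : ℝ) < A.card →
        (4 * K + x * K / 16) * A.card ≤ 2 * t * ((fun _ => K * ε / 2) A) ^ 2 := by
      intro A hA _ _
      have h1 : (A.card : ℝ) ≤ S.card := by exact_mod_cast Finset.card_le_card hA
      -- The tightest case: `16 + x/4 ≤ x/2` is the condition `x ≥ 64`.
      calc (4 * K + x * K / 16) * A.card ≤ (4 * K + x * K / 16) * (4 * K) := by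
            gcongr
            linarith
        _ ≤ x * K * K / 2 := by nlinarith [mul_self_nonneg (K : ℝ)]
        _ = 2 * t * (K * ε / 2) ^ 2 := by rw [hxdef]; ring
    refine le_trans (measureReal_mono ?_ (by finiteness)) (key
      (fun ω => ∃ A ⊆ S, True ∧ (fun _ => K * ε / 2) A ≤
        ∑ i ∈ A, ((1 - η i) - empMean (rewardTable fun p => b p ω) a t i))
      (fun ω => ∃ A ⊆ S, True ∧ (fun _ => K * ε / 2) A ≤
        ∑ i ∈ A, (empMean (rewardTable fun p => b p ω) a t i - (1 - η i))) _
      (measure_exists_deviation_le (t := t) (N := 4 * K) _ _ h4' ?_ ?_ hexp)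
      (measure_exists_deviation_le (t := t) (N := 4 * K) _ _ h4' ?_ ?_ hexp))
    · intro ω hω
      simp only [Set.mem_ofPred_eq, IsGoodRound, if_neg h4] at hω ⊢
      by_contra! hcon
      exact hω ⟨fun A hA => hcon.1 A hA trivial, fun D hD => hcon.2 D hD trivial⟩
    · exact fun _ _ _ => hc
    · exact fun A _ _ => measure_le_sum_neg_deviation hb hind hη h ht A hc.le
    · exact fun _ _ _ => hc
    · exact fun A _ _ => measure_le_sum_deviation hb hind hη h ht A hc.le

end BadRound

/-! ### The success probability of the algorithm -/

lemma measure_and_of_depends_disjoint {ι Ω : Type*} [Fintype ι] [MeasurableSpace Ω] {P : Measure Ω}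
    {b : ι → Ω → Bool} (hb : ∀ p, Measurable (b p)) (hind : iIndepFun b P) {I J : Finset ι}
    (hIJ : Disjoint I J) {E G : (ι → Bool) → Prop}
    (hE : ∀ f f', (∀ p ∈ I, f p = f' p) → (E f ↔ E f'))
    (hG : ∀ f f', (∀ p ∈ J, f p = f' p) → (G f ↔ G f')) :
    P.real {ω | E (fun p => b p ω) ∧ G (fun p => b p ω)} =
      P.real {ω | E (fun p => b p ω)} * P.real {ω | G (fun p => b p ω)} := by
  classical
  -- Coordinates outside `A` are filled with `false`, so that an event depending on `A` only becomes
  -- an event about the restricted family.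
  let ext : ∀ A : Finset ι, (A → Bool) → ι → Bool := fun A f p => if h : p ∈ A then f ⟨p, h⟩ else false
  have hext : ∀ (A : Finset ι) (ω : Ω), ∀ p ∈ A, b p ω = ext A (fun p => b p ω) p := by
    intro A ω p hp
    simp [ext, hp]
  have h := hind.indepFun_finset I J hIJ hb
  have h1 : {ω | E (fun p => b p ω)} =
      (fun ω (p : I) => b p ω) ⁻¹' {f | E (ext I f)} := by
    ext ω
    exact hE _ _ (hext I ω)
  have h2 : {ω | G (fun p => b p ω)} =
      (fun ω (p : J) => b p ω) ⁻¹' {f | G (ext J f)} := by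
    ext ω
    exact hG _ _ (hext J ω)
  have h3 := h.measure_inter_preimage_eq_mul {f | E (ext I f)} {f | G (ext J f)}
    (Set.toFinite _).measurableSet (Set.toFinite _).measurableSet
  rw [← h1, ← h2] at h3
  have h4 : {ω | E (fun p => b p ω) ∧ G (fun p => b p ω)} =
      {ω | E (fun p => b p ω)} ∩ {ω | G (fun p => b p ω)} := rfl
  rw [h4]
  simp only [measureReal_def, h3, ENNReal.toReal_mul]

lemma card_bestFeasible_le {n K : ℕ} (μ : Fin n → ℝ) (S T : Finset (Fin n)) :
    (bestFeasible K μ S T).card ≤ K := by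
  classical
  unfold bestFeasible
  split_ifs with h
  · exact h.choose_spec.1.2.2.le
  · simp

section Success

variable {n s : ℕ} {Ω : Type*} [MeasurableSpace Ω] {P : Measure Ω} [IsProbabilityMeasure P]
  {b : Fin n × Fin s → Ω → Bool} {η : Fin n → ℝ}

/-- Decompose by the finitely many values `v` of the state. The event that the state is `v` depends
on pulls before `a`; inaccuracy for fixed `v` depends on later pulls. Each term factors, and the
probabilities of the values add up to 1. -/
lemma measure_not_isGoodAt_le (hb : ∀ p, Measurable (b p)) (hind : iIndepFun b P)
    (hη : ∀ p, P.real {ω | b p ω = false} = η p.1) {K q r : ℕ} (hK : 1 ≤ K) (hKn : K ≤ n)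
    {ε : ℕ → ℝ} (hε : 0 < ε r)
    (hfit : 0 < armCount n r → pullCount n q r + roundPulls q r (armCount n r) ≤ s)
    (hpos : 0 < armCount n r → 0 < roundPulls q r (armCount n r))
    (hx : 0 < armCount n r → 64 ≤ roundPulls q r (armCount n r) * ε r ^ 2)
    {z : ℝ} (hz : 0 < armCount n r →
      z ≤ roundPulls q r (armCount n r) * ε r ^ 2 * K / 16) :
    P.real {ω | ¬ IsGoodAt K q (rewardTable fun p => b p ω) (fun i => 1 - η i) ε r} ≤
      2 * Real.exp (-z) := by
  classical
  have hnn := fun f : Fin n × Fin s → Bool => rewardTable_nonneg f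
  by_cases hN : 0 < armCount n r
  swap
  · have : ∀ ω, IsGoodAt K q (rewardTable fun p => b p ω) (fun i => 1 - η i) ε r :=
      fun ω ha => absurd (armCount_pos_of_isActive hKn (hnn _) ha) hN
    simp only [this, not_true_eq_false, Set.ofPred_false, measureReal_empty]
    positivity
  have hfit' := hfit hN
  set a := pullCount n q r with ha
  set t := roundPulls q r (armCount n r) with ht
  let g : (Fin n × Fin s → Bool) → Finset (Fin n) × Finset (Fin n) := fun f =>
    ((stateAt K q (rewardTable f) r).remaining, (stateAt K q (rewardTable f) r).accepted)
  let bad : Finset (Fin n) × Finset (Fin n) → (Fin n × Fin s → Bool) → Prop := fun v f =>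
    ¬ IsGoodRound K (ε r) (empMean (rewardTable f) a t) (fun i => 1 - η i) v.1
      (bestFeasible K (fun i => 1 - η i) v.1 v.2)
  have hgmeas : Measurable fun ω => g fun p => b p ω :=
    (measurable_of_finite g).comp (measurable_pi_lambda _ hb)
  have hsub : {ω | ¬ IsGoodAt K q (rewardTable fun p => b p ω) (fun i => 1 - η i) ε r} ⊆
      ⋃ v ∈ (Finset.univ : Finset (Finset (Fin n) × Finset (Fin n))),
        {ω | (g fun p => b p ω) = v ∧ bad v fun p => b p ω} := by
    intro ω hω
    simp only [Set.mem_iUnion, Set.mem_ofPred_eq]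
    refine ⟨_, Finset.mem_univ _, rfl, fun h => hω fun _ => h⟩
  have hindep : ∀ v, P.real {ω | (g fun p => b p ω) = v ∧ bad v fun p => b p ω} =
      P.real {ω | (g fun p => b p ω) = v} * P.real {ω | bad v fun p => b p ω} := by
    intro v
    refine measure_and_of_depends_disjoint hb hind (E := fun f => g f = v) (G := bad v)
      (I := Finset.univ.filter fun p => p.2.1 < a) (J := Finset.univ.filter fun p => a ≤ p.2.1)
      ?_ ?_ ?_
    · rw [Finset.disjoint_left]
      intro p hp hp'
      simp only [Finset.mem_filter, Finset.mem_univ, true_and] at hp hp'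
      omega
    · intro f f' hff
      have : stateAt K q (rewardTable f) r = stateAt K q (rewardTable f') r := by
        refine stateAt_congr hKn (hnn f) r fun i j hj => ?_
        unfold rewardTable
        split_ifs with h <;> simp_all
      simp only [g, this]
    · intro f f' hff
      have : empMean (rewardTable f) a t = empMean (rewardTable f') a t := by
        funext i
        unfold empMean
        congr 1
        refine Finset.sum_congr rfl fun j hj => ?_
        have := (Finset.mem_Ico.mp hj).1
        unfold rewardTable
        split_ifs with h <;> simp_all
      simp only [bad, this]
  have hbad : ∀ v, P.real {ω | bad v fun p => b p ω} ≤ 2 * Real.exp (-z) := by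
    intro v
    refine (measure_not_isGoodRound_le hb hind hη hfit' (hpos hN) hK hε (hx hN) v.1 _
      (card_bestFeasible_le _ _ _)).trans ?_
    have := hz hN
    gcongr
  have hsum : ∑ v, P.real {ω | (g fun p => b p ω) = v} = 1 := by
    have := sum_measureReal_preimage_singleton (μ := P) Finset.univ
      (f := fun ω => g fun p => b p ω) (fun v _ => hgmeas (measurableSet_singleton v))
    rw [Finset.coe_univ, Set.preimage_univ, probReal_univ] at this
    exact this
  calc P.real {ω | ¬ IsGoodAt K q (rewardTable fun p => b p ω) (fun i => 1 - η i) ε r}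
      ≤ ∑ v, P.real {ω | (g fun p => b p ω) = v ∧ bad v fun p => b p ω} :=
        (measureReal_mono hsub (measure_ne_top _ _)).trans (measureReal_biUnion_finset_le _ _)
    _ = ∑ v, P.real {ω | (g fun p => b p ω) = v} * P.real {ω | bad v fun p => b p ω} :=
        Finset.sum_congr rfl fun v _ => hindep v
    _ ≤ ∑ v, P.real {ω | (g fun p => b p ω) = v} * (2 * Real.exp (-z)) :=
        Finset.sum_le_sum fun v _ => mul_le_mul_of_nonneg_left (hbad v) measureReal_nonneg
    _ = 2 * Real.exp (-z) := by rw [← Finset.sum_mul, hsum, one_mul]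

/-- The accuracy required in round `r`. -/
noncomputable def roundAccuracy (Δ : ℝ) (r : ℕ) : ℝ := Δ / 25 * (24 / 25) ^ r

lemma sum_roundAccuracy_le {Δ : ℝ} (hΔ : 0 ≤ Δ) (r : ℕ) :
    ∑ i ∈ Finset.range r, roundAccuracy Δ i ≤ Δ := by
  have h := mul_neg_geom_sum (24 / 25 : ℝ) r
  have h' : (0 : ℝ) ≤ (24 / 25) ^ r := by positivity
  have h2 : ∑ i ∈ Finset.range r, (24 / 25 : ℝ) ^ i ≤ 25 := by linarith
  unfold roundAccuracy
  rw [← Finset.mul_sum]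
  calc Δ / 25 * ∑ i ∈ Finset.range r, (24 / 25 : ℝ) ^ i ≤ Δ / 25 * 25 := by gcongr
    _ = Δ := by ring

lemma le_roundPulls_mul_sq {K q r : ℕ} {Δ L : ℝ} (hn : 0 < n) (hΔ : 0 < Δ) (hΔ' : Δ ≤ 1 / 2)
    (hL : 0 ≤ L) (hq : 10 ^ 7 * (n / Δ ^ 2 * (1 + L / K)) ≤ q) (hN : 0 < armCount n r) :
    500 * (1 + r / 10) * (1 + L / K) ≤
      roundPulls q r (armCount n r) * roundAccuracy Δ r ^ 2 := by
  have hn' : (0 : ℝ) < n := by exact_mod_cast hn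
  have hLK : 0 ≤ L / K := by positivity
  have hΔ2 : Δ ^ 2 ≤ 1 := by nlinarith
  have hq16 : 16 * (n : ℝ) ≤ q := by
    refine le_trans ?_ hq
    have h1 : (n : ℝ) ≤ n / Δ ^ 2 := by
      rw [le_div_iff₀ (by positivity)]
      nlinarith
    have h2 : (n : ℝ) / Δ ^ 2 * 1 ≤ n / Δ ^ 2 * (1 + L / K) := by
      gcongr
      linarith
    linarith
  have hber : 1 + (r : ℝ) / 10 ≤ (11 / 10) ^ r := by
    have := one_add_mul_le_pow (a := (1 / 10 : ℝ)) (by norm_num) r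
    calc 1 + (r : ℝ) / 10 = 1 + r * (1 / 10) := by ring
      _ ≤ (1 + 1 / 10) ^ r := this
      _ = _ := by norm_num
  calc 500 * (1 + (r : ℝ) / 10) * (1 + L / K)
      -- Growth of the pulls beats the shrinking accuracy: `6/5 * (24/25)^2 > 11/10`. The factor 500
      -- is `10^7 / (32 * 25^2)`.
      ≤ 500 * ((6 / 5) * (24 / 25) ^ 2) ^ r * (1 + L / K) := by
        have : (11 / 10 : ℝ) ^ r ≤ ((6 / 5) * (24 / 25) ^ 2) ^ r := by
          gcongr
          norm_num
        gcongr
        linarith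
    _ = (6 / 5 : ℝ) ^ r * (10 ^ 7 * (n / Δ ^ 2 * (1 + L / K))) / (32 * n) *
          roundAccuracy Δ r ^ 2 := by
        unfold roundAccuracy
        rw [mul_pow, ← pow_mul, mul_pow, ← pow_mul, mul_comm 2 r]
        field_simp
        norm_num
    _ ≤ (6 / 5 : ℝ) ^ r * q / (32 * n) * roundAccuracy Δ r ^ 2 := by gcongr
    _ ≤ _ := by
        gcongr
        exact le_roundPulls hN hn hq16

lemma measure_not_isDeltaOptimal_le (hb : ∀ p, Measurable (b p)) (hind : iIndepFun b P)
    (hη : ∀ p, P.real {ω | b p ω = false} = η p.1) {K q : ℕ} (hK : 1 ≤ K) (hKn : K ≤ n)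
    {Δ δ : ℝ} (hΔ : 0 < Δ) (hΔ' : Δ ≤ 1 / 2) (hδ : 0 < δ) (hδ' : δ ≤ 1)
    (hq : 10 ^ 7 * (n / Δ ^ 2 * (1 + Real.log (1 / δ) / K)) ≤ q)
    (hs : 25 * (q / (n : ℝ) ^ (0.3 : ℝ)) ≤ s) :
    P.real {ω | ¬ IsDeltaOptimal η K Δ (optMAI K q (rewardTable fun p => b p ω)).accepted} ≤
      δ / 2 := by
  set L := Real.log (1 / δ) with hLdef
  have hL : 0 ≤ L := Real.log_nonneg (by rw [le_div_iff₀ hδ]; linarith)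
  have hexpL : Real.exp (-L) = δ := by
    rw [hLdef, one_div, Real.log_inv, neg_neg, Real.exp_log hδ]
  have hn : 0 < n := by omega
  have hK' : (1 : ℝ) ≤ K := by exact_mod_cast hK
  have hε : ∀ r, 0 < roundAccuracy Δ r := fun r => by unfold roundAccuracy; positivity
  have hround : ∀ r, P.real {ω | ¬ IsGoodAt K q (rewardTable fun p => b p ω) (fun i => 1 - η i)
      (roundAccuracy Δ) r} ≤ 2 * Real.exp (-(10 + r + L)) := by
    intro r
    have hlow : 0 < armCount n r → 500 * (1 + r / 10) * (1 + L / K) ≤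
        roundPulls q r (armCount n r) * roundAccuracy Δ r ^ 2 :=
      le_roundPulls_mul_sq hn hΔ hΔ' hL hq
    have hbase : (500 : ℝ) ≤ 500 * (1 + r / 10) * (1 + L / K) := by
      have h1 : (0 : ℝ) ≤ r / 10 := by positivity
      have h2 : 0 ≤ L / K := by positivity
      nlinarith [mul_nonneg h1 h2]
    refine measure_not_isGoodAt_le hb hind hη hK hKn (hε r) ?_ ?_ ?_ ?_
    · intro hN
      rw [← pullCount_succ]
      have h1 : ∀ i < r + 1, 0 < armCount n i := fun i hi =>
        armCount_pos_of_le (Nat.lt_succ_iff.mp hi) hN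
      exact_mod_cast (pullCount_le (q := q) h1).trans hs
    · intro hN
      by_contra! h0
      have := hlow hN
      rw [Nat.le_zero.mp h0, Nat.cast_zero, zero_mul] at this
      linarith
    · intro hN
      linarith [hlow hN]
    · intro hN
      -- Multiplying `1 + L / K` by the `K` of the exponent gives `K + L`. The three summands on the
      -- left later give a small constant, a factor summable over rounds, and `δ`.
      have h1 : (10 + r + L) ≤ 500 * (1 + (r : ℝ) / 10) * (1 + L / K) * K / 16 := by
        have h2 : (1 + L / K) * K = K + L := by field_simp
        have h3 : 500 * (1 + (r : ℝ) / 10) * (1 + L / K) * K / 16 =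
          500 * (1 + (r : ℝ) / 10) * (K + L) / 16 := by rw [← h2]; ring
        rw [h3]
        have hr : (0 : ℝ) ≤ r := Nat.cast_nonneg r
        nlinarith [mul_nonneg hr hL, mul_nonneg hr (by linarith : (0 : ℝ) ≤ K - 1)]
      refine h1.trans ?_
      have := hlow hN
      gcongr
  have hsub : {ω | ¬ IsDeltaOptimal η K Δ (optMAI K q (rewardTable fun p => b p ω)).accepted} ⊆
      ⋃ r ∈ Finset.range n, {ω | ¬ IsGoodAt K q (rewardTable fun p => b p ω) (fun i => 1 - η i)
        (roundAccuracy Δ) r} := by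
    intro ω hω
    by_contra hcon
    simp only [Set.mem_iUnion, Set.mem_ofPred_eq, not_exists, not_not, Finset.mem_range] at hcon
    exact hω (isDeltaOptimal_optMAI hK hKn (rewardTable_nonneg _) (fun r => (hε r).le)
      (sum_roundAccuracy_le hΔ.le n) hcon)
  have hgeom : ∑ r ∈ Finset.range n, (1 / 2 : ℝ) ^ r ≤ 2 := by
    have h := mul_neg_geom_sum (1 / 2 : ℝ) n
    have h' : (0 : ℝ) ≤ (1 / 2) ^ n := by positivity
    linarith
  have hexp10 : Real.exp (-10) ≤ 1 / 11 := by
    rw [Real.exp_neg, ← one_div]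
    gcongr
    linarith [Real.add_one_le_exp (10 : ℝ)]
  calc P.real {ω | ¬ IsDeltaOptimal η K Δ (optMAI K q (rewardTable fun p => b p ω)).accepted}
      ≤ ∑ r ∈ Finset.range n, P.real {ω | ¬ IsGoodAt K q (rewardTable fun p => b p ω)
          (fun i => 1 - η i) (roundAccuracy Δ) r} :=
        (measureReal_mono hsub (measure_ne_top _ _)).trans (measureReal_biUnion_finset_le _ _)
    _ ≤ ∑ r ∈ Finset.range n, 2 / 11 * δ * (1 / 2) ^ r := by
        refine Finset.sum_le_sum fun r _ => (hround r).trans ?_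
        have h1 : Real.exp (-(10 + r + L)) = Real.exp (-10) * Real.exp (-1) ^ r * δ := by
          rw [← hexpL, ← Real.exp_nat_mul, ← Real.exp_add, ← Real.exp_add]
          congr 1
          ring
        have h2 : Real.exp (-1) ≤ 1 / 2 := by
          rw [Real.exp_neg, ← one_div]
          gcongr
          linarith [Real.add_one_le_exp (1 : ℝ)]
        rw [h1]
        calc 2 * (Real.exp (-10) * Real.exp (-1) ^ r * δ) ≤ 2 * (1 / 11 * (1 / 2) ^ r * δ) := by
              gcongr
          _ = _ := by ring
    _ = 2 / 11 * δ * ∑ r ∈ Finset.range n, (1 / 2 : ℝ) ^ r := by rw [Finset.mul_sum]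
    _ ≤ 2 / 11 * δ * 2 := by gcongr
    _ ≤ δ / 2 := by linarith

end Success

/-! ### Maclaurin's inequality -/

section Maclaurin

open Finset

variable {ι : Type*} [Fintype ι] [DecidableEq ι] (x : ι → ℝ)

/-- The elementary symmetric polynomial of degree `m`. -/
noncomputable def elemSymm (m : ℕ) : ℝ := ∑ A ∈ powersetCard m univ, ∏ i ∈ A, x i

/-- The part of the elementary symmetric polynomial of degree `m` that contains the factor `x i`. -/
noncomputable def elemSymmAt (m : ℕ) (i : ι) : ℝ :=
  ∑ A ∈ (powersetCard m univ).filter (fun A => i ∈ A), ∏ j ∈ A, x j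

variable {x}

lemma sum_mul_elemSymmAt (m : ℕ) (y : ι → ℝ) :
    ∑ i, y i * elemSymmAt x m i =
      ∑ A ∈ powersetCard m (univ : Finset ι), (∑ i ∈ A, y i) * ∏ j ∈ A, x j := by
  simp only [elemSymmAt, Finset.mul_sum, Finset.sum_mul]
  rw [Finset.sum_comm' (t' := powersetCard m univ) (s' := fun A => A)]
  intro i A
  simp only [mem_univ, mem_filter, true_and]
  tauto

lemma sum_elemSymmAt (m : ℕ) : ∑ i, elemSymmAt x m i = m * elemSymm x m := by
  have h := sum_mul_elemSymmAt (x := x) m (fun _ => 1)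
  simp only [one_mul] at h
  rw [h, elemSymm, Finset.mul_sum]
  refine sum_congr rfl fun A hA => ?_
  rw [sum_const, (mem_powersetCard.mp hA).2]
  simp

/-- In the product of the first and the `m`-th polynomial, pairs `(A, i)` with `i ∉ A` correspond to
sets of size `m + 1` with a marked element; pairs with `i ∈ A` form the subtracted sum. -/
lemma succ_mul_elemSymm_succ (m : ℕ) :
    (m + 1 : ℝ) * elemSymm x (m + 1) = (∑ i, x i) * elemSymm x m - ∑ i, x i * elemSymmAt x m i := by
  have h1 : (m + 1 : ℝ) * elemSymm x (m + 1) =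
      ∑ B ∈ powersetCard (m + 1) (univ : Finset ι), ∑ i ∈ B, ∏ j ∈ B, x j := by
    rw [elemSymm, Finset.mul_sum]
    refine sum_congr rfl fun B hB => ?_
    rw [sum_const, (mem_powersetCard.mp hB).2, nsmul_eq_mul]
    push_cast
    rfl
  have h2 : ∑ B ∈ powersetCard (m + 1) (univ : Finset ι), ∑ i ∈ B, ∏ j ∈ B, x j =
      ∑ A ∈ powersetCard m (univ : Finset ι), ∑ i ∈ Aᶜ, x i * ∏ j ∈ A, x j := by
    rw [Finset.sum_sigma', Finset.sum_sigma']
    refine Finset.sum_bij' (fun p _ => ⟨p.1.erase p.2, p.2⟩) (fun p _ => ⟨insert p.2 p.1, p.2⟩)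
      ?_ ?_ ?_ ?_ ?_
    · rintro ⟨B, i⟩ h
      simp only [mem_sigma, mem_powersetCard, subset_univ, true_and, mem_compl] at h ⊢
      refine ⟨?_, notMem_erase _ _⟩
      rw [card_erase_of_mem h.2, h.1]
      rfl
    · rintro ⟨A, i⟩ h
      simp only [mem_sigma, mem_powersetCard, subset_univ, true_and, mem_compl] at h ⊢
      exact ⟨by rw [card_insert_of_notMem h.2, h.1], mem_insert_self _ _⟩
    · rintro ⟨B, i⟩ h
      simp only [mem_sigma] at h
      simp only [insert_erase h.2]
    · rintro ⟨A, i⟩ h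
      simp only [mem_sigma, mem_compl] at h
      simp only [erase_insert h.2]
    · rintro ⟨B, i⟩ h
      simp only [mem_sigma] at h
      exact (mul_prod_erase B x h.2).symm
  rw [h1, h2, sum_mul_elemSymmAt, elemSymm, Finset.mul_sum, ← Finset.sum_sub_distrib]
  refine sum_congr rfl fun A _ => ?_
  rw [← Finset.sum_mul, ← sub_mul, ← Finset.sum_compl_add_sum A x]
  ring

/-- The transposition of `i` and `j` carries the sets containing `i` to those containing `j` and can
only increase the product. -/
lemma elemSymmAt_mono (hx : ∀ i, 0 ≤ x i) (m : ℕ) {i j : ι} (hij : x i ≤ x j) :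
    elemSymmAt x m i ≤ elemSymmAt x m j := by
  have h1 : elemSymmAt x m j = ∑ A ∈ (powersetCard m univ).filter (fun A => i ∈ A),
      ∏ l ∈ A.map (Equiv.swap i j).toEmbedding, x l := by
    symm
    have hinv : ∀ A : Finset ι,
        (A.map (Equiv.swap i j).toEmbedding).map (Equiv.swap i j).toEmbedding = A := by
      intro A
      ext l
      simp
    refine Finset.sum_bij' (fun A _ => A.map (Equiv.swap i j).toEmbedding)
      (fun A _ => A.map (Equiv.swap i j).toEmbedding) ?_ ?_ (fun A _ => hinv A) (fun A _ => hinv A)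
      (fun _ _ => rfl)
    · intro A hA
      simp only [mem_filter, mem_powersetCard, subset_univ, true_and, card_map] at hA ⊢
      exact ⟨hA.1, mem_map.mpr ⟨i, hA.2, by simp⟩⟩
    · intro A hA
      simp only [mem_filter, mem_powersetCard, subset_univ, true_and, card_map] at hA ⊢
      exact ⟨hA.1, mem_map.mpr ⟨j, hA.2, by simp⟩⟩
  rw [h1]
  refine sum_le_sum fun A hA => ?_
  have hi : i ∈ A := (mem_filter.mp hA).2
  by_cases hj : j ∈ A
  · have : A.map (Equiv.swap i j).toEmbedding = A := by
      apply eq_of_subset_of_card_le _ (by simp)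
      intro l hl
      obtain ⟨k, hk, rfl⟩ := mem_map.mp hl
      simp only [Equiv.coe_toEmbedding, Equiv.swap_apply_def]
      split_ifs <;> assumption
    rw [this]
  · rw [prod_map]
    refine prod_le_prod (fun l _ => hx l) fun l hl => ?_
    simp only [Equiv.coe_toEmbedding, Equiv.swap_apply_def]
    split_ifs with h h'
    · rwa [h]
    · rw [h'] at hl
      exact absurd hl hj
    · exact le_rfl

/-- Chebyshev's sum inequality: `x i` and `elemSymmAt x m i` are ordered alike, which bounds the
subtracted sum from below by its averaged version. -/
lemma card_mul_succ_mul_elemSymm_succ_le (hx : ∀ i, 0 ≤ x i) (m : ℕ) :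
    Fintype.card ι * ((m + 1 : ℝ) * elemSymm x (m + 1)) ≤
      (Fintype.card ι - m) * ((∑ i, x i) * elemSymm x m) := by
  have hmono : Monovary x (elemSymmAt x m) := by
    intro i j hij
    by_contra! h
    exact absurd (elemSymmAt_mono hx m h.le) (not_le.mpr hij)
  have h := hmono.sum_mul_sum_le_card_mul_sum
  rw [sum_elemSymmAt] at h
  rw [succ_mul_elemSymm_succ]
  linarith

/-- Maclaurin's inequality between the first and the `m`-th elementary symmetric mean. -/
lemma elemSymm_le_choose_mul_pow (hx : ∀ i, 0 ≤ x i) {m : ℕ} (hm : m ≤ Fintype.card ι) :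
    elemSymm x m ≤ (Fintype.card ι).choose m * ((∑ i, x i) / Fintype.card ι) ^ m := by
  induction m with
  | zero => simp [elemSymm]
  | succ m ih =>
    have hN : (0 : ℝ) < Fintype.card ι := by
      have : 0 < Fintype.card ι := by omega
      exact_mod_cast this
    have hm' : (m : ℝ) ≤ Fintype.card ι := by exact_mod_cast (Nat.le_of_succ_le hm)
    have hE : 0 ≤ ∑ i, x i := sum_nonneg fun i _ => hx i
    have h1 := card_mul_succ_mul_elemSymm_succ_le hx m
    have h2 : ((Fintype.card ι).choose (m + 1) : ℝ) * (m + 1) =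
        (Fintype.card ι).choose m * (Fintype.card ι - m) := by
      rw [← Nat.cast_sub (by omega)]
      exact_mod_cast Nat.choose_succ_right_eq _ _
    have h3 : (0 : ℝ) < Fintype.card ι * (m + 1) := by positivity
    refine le_of_mul_le_mul_left ?_ h3
    calc Fintype.card ι * (m + 1 : ℝ) * elemSymm x (m + 1)
        ≤ (Fintype.card ι - m) * ((∑ i, x i) * elemSymm x m) := by rw [mul_assoc]; exact h1
      _ ≤ (Fintype.card ι - m) * ((∑ i, x i) * ((Fintype.card ι).choose m *
          ((∑ i, x i) / Fintype.card ι) ^ m)) := by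
          have := ih (by omega)
          have h4 : (0 : ℝ) ≤ Fintype.card ι - m := by linarith
          gcongr
      _ = (((Fintype.card ι).choose m : ℝ) * (Fintype.card ι - m)) * (Fintype.card ι *
          ((∑ i, x i) / Fintype.card ι)) * ((∑ i, x i) / Fintype.card ι) ^ m := by
          rw [mul_div_cancel₀ _ hN.ne']
          ring
      _ = _ := by
          rw [← h2, pow_succ]
          ring

end Maclaurin

/-! ### Majority voting by random panels -/

lemma card_le_of_majorityVote_ne {n : ℕ} {A : Finset (Fin n)} {l : Fin n → Bool} {c : Bool}
    (h : majorityVote A l ≠ c) : A.card ≤ 2 * (A.filter (fun i => l i ≠ c)).card := by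
  have h1 := Finset.card_filter_add_card_filter_not (s := A) (fun i => l i = true)
  unfold majorityVote at h
  cases c
  · simp only [ne_eq, decide_eq_false_iff_not, not_not, Bool.not_eq_false] at h ⊢
    exact h.le
  · simp only [ne_eq, decide_eq_true_eq] at h ⊢
    omega

section Vote

/-- The mean of `exp (γ Z)` for a variable `Z` that is `1` with probability `e` and `-1` otherwise. -/
noncomputable def signMGF (γ e : ℝ) : ℝ := e * Real.exp γ + (1 - e) * Real.exp (-γ)

/-- With `e = (1 - γ) / 2` the left side is `cosh γ - γ sinh γ ≤ exp (γ²/2) - γ² ≤ 1 - γ²/4`, using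
`γ ≤ 1`. -/
lemma signMGF_le {e : ℝ} (he0 : 0 ≤ e) (he : e ≤ 1 / 2) :
    signMGF (1 - 2 * e) e ≤ Real.exp (-((1 - 2 * e) ^ 2 / 4)) := by
  set γ := 1 - 2 * e with hγ
  have hγ0 : 0 ≤ γ := by linarith
  have hγ1 : γ ≤ 1 := by linarith
  have h1 : signMGF γ e = Real.cosh γ - γ * Real.sinh γ := by
    have : e = (1 - γ) / 2 := by linarith
    rw [signMGF, this, Real.cosh_eq, Real.sinh_eq]
    ring
  have h2 := Real.cosh_le_exp_half_sq γ
  have h3 : γ ≤ Real.sinh γ := Real.self_le_sinh_iff.mpr hγ0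
  have hγ2 : γ ^ 2 ≤ 1 := by nlinarith
  have h4 : Real.exp (γ ^ 2 / 2) ≤ 1 + γ ^ 2 / 2 + (γ ^ 2 / 2) ^ 2 := by
    have := Real.abs_exp_sub_one_sub_id_le (x := γ ^ 2 / 2)
      (by rw [abs_of_nonneg (by positivity)]; linarith)
    linarith [(abs_le.mp this).2]
  have h5 := Real.add_one_le_exp (-(γ ^ 2 / 4))
  rw [h1]
  nlinarith [mul_le_mul_of_nonneg_left h3 hγ0, mul_nonneg (sq_nonneg γ) (by linarith : 0 ≤ 1 - γ ^ 2)]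

variable {Ω X : Type*} [MeasurableSpace Ω] {P : Measure Ω} {n : ℕ}
  {c : X → Bool} {η : Fin n → ℝ} {w : Fin n → X → Ω → Bool}

lemma measurableSet_ne (hw : IsNoisyCrowd P c η w) (i : Fin n) (x : X) :
    MeasurableSet {ω | w i x ω ≠ c x} :=
  hw.measurable_label i x (measurableSet_singleton (c x)).compl

variable [IsProbabilityMeasure P]

lemma mgf_sign (hw : IsNoisyCrowd P c η w) (i : Fin n) (x : X) (γ : ℝ) :
    Integrable (fun ω => Real.exp (γ * if w i x ω ≠ c x then 1 else -1)) P ∧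
      mgf (fun ω => if w i x ω ≠ c x then (1 : ℝ) else -1) P γ = signMGF γ (η i) := by
  have hm := measurableSet_ne hw i x
  have h1 : (fun ω => Real.exp (γ * if w i x ω ≠ c x then 1 else -1)) = fun ω =>
      Real.exp (-γ) + (Real.exp γ - Real.exp (-γ)) *
        {ω | w i x ω ≠ c x}.indicator (1 : Ω → ℝ) ω := by
    funext ω
    by_cases h : w i x ω ≠ c x
    · simp [Set.indicator, h]
    · simp [Set.indicator, h]
  have hint : Integrable ({ω | w i x ω ≠ c x}.indicator (1 : Ω → ℝ)) P :=
    (integrable_const (1 : ℝ)).indicator hm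
  constructor
  · rw [h1]
    exact (integrable_const _).add (hint.const_mul _)
  · rw [mgf, h1, integral_add (integrable_const _) (hint.const_mul _), integral_const_mul,
      integral_indicator_one hm, hw.error i x, integral_const, probReal_univ, signMGF]
    simp only [smul_eq_mul]
    ring

lemma measure_panel_wrong_le (hw : IsNoisyCrowd P c η w) (x : X) (A : Finset (Fin n)) {γ : ℝ}
    (hγ : 0 ≤ γ) :
    P.real {ω | A.card ≤ 2 * (A.filter (fun i => w i x ω ≠ c x)).card} ≤
      ∏ i ∈ A, signMGF γ (η i) := by
  let Z : Fin n → Ω → ℝ := fun i ω => if w i x ω ≠ c x then 1 else -1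
  have hf : Measurable (fun l : Bool => if l ≠ c x then (1 : ℝ) else -1) := measurable_of_finite _
  have hZm : ∀ i, Measurable (Z i) := fun i => hf.comp (hw.measurable_label i x)
  have hinj : Function.Injective fun i : Fin n => (i, x) := fun i j h => (Prod.mk.inj h).1
  have hZind : iIndepFun Z P :=
    (hw.indep.precomp hinj).comp (fun _ (l : Bool) => if l ≠ c x then (1 : ℝ) else -1) fun _ => hf
  have hsub : {ω | A.card ≤ 2 * (A.filter (fun i => w i x ω ≠ c x)).card} ⊆
      {ω | 0 ≤ (∑ i ∈ A, Z i) ω} := by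
    intro ω hω
    have h1 : (∑ i ∈ A, Z i) ω = 2 * (A.filter (fun i => w i x ω ≠ c x)).card - A.card := by
      rw [Finset.sum_apply, Finset.card_filter]
      push_cast
      rw [Finset.card_eq_sum_ones, Finset.mul_sum]
      push_cast
      rw [← Finset.sum_sub_distrib]
      refine Finset.sum_congr rfl fun i _ => ?_
      simp only [Z]
      split_ifs <;> norm_num
    have h2 : (A.card : ℝ) ≤ 2 * (A.filter (fun i => w i x ω ≠ c x)).card := by exact_mod_cast hω
    rw [Set.mem_ofPred_eq, h1]
    linarith
  have hint : Integrable (fun ω => Real.exp (γ * (∑ i ∈ A, Z i) ω)) P :=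
    hZind.integrable_exp_mul_sum hZm fun i _ => (mgf_sign hw i x γ).1
  calc P.real {ω | A.card ≤ 2 * (A.filter (fun i => w i x ω ≠ c x)).card}
      ≤ P.real {ω | 0 ≤ (∑ i ∈ A, Z i) ω} := measureReal_mono hsub
    _ ≤ Real.exp (-γ * 0) * mgf (∑ i ∈ A, Z i) P γ := measure_ge_le_exp_mul_mgf 0 hγ hint
    _ = ∏ i ∈ A, signMGF γ (η i) := by
        rw [mul_zero, Real.exp_zero, one_mul, hZind.mgf_sum hZm]
        exact Finset.prod_congr rfl fun i _ => (mgf_sign hw i x γ).2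

/-- Independence of panel and labels allows Chernoff's bound for each fixed panel; uniformity turns
the average over panels into an elementary symmetric mean, to which Maclaurin's inequality applies.
-/
lemma measure_votedLabel_ne_le {s m : ℕ} {M : Fin s → Ω → Finset (Fin n)} (hw : IsNoisyCrowd P c η w)
    (hM : IsRandomPanels P m w M) (y : Fin s → X) (j : Fin s) (hn : 0 < n) (hm : m ≤ n)
    (hη : ∀ i, 0 ≤ η i ∧ η i ≤ 1 / 2) (havg : avgError η Finset.univ ≤ 1 / 2) :
    P.real {ω | votedLabel w M y j ω ≠ c (y j)} ≤
      Real.exp (-(m * (1 - 2 * avgError η Finset.univ) ^ 2 / 4)) := by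
  set e := avgError η Finset.univ with he
  set γ := 1 - 2 * e with hγ
  have hn' : (0 : ℝ) < n := by exact_mod_cast hn
  have he' : (∑ i, η i) / n = e := by rw [he, avgError, Finset.card_univ, Fintype.card_fin]
  have he0 : 0 ≤ e := by
    rw [← he']
    exact div_nonneg (Finset.sum_nonneg fun i _ => (hη i).1) hn'.le
  let W : Finset (Fin n) → Set (Fin n × X → Bool) := fun A =>
    {f | A.card ≤ 2 * (A.filter (fun i => f (i, y j) ≠ c (y j))).card}
  have hWmeas : ∀ A, MeasurableSet (W A) := by
    intro A
    have h1 : Measurable fun (f : Fin n × X → Bool) (i : Fin n) => f (i, y j) :=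
      measurable_pi_lambda _ fun i => measurable_pi_apply _
    exact h1 (Set.toFinite {g : Fin n → Bool |
      A.card ≤ 2 * (A.filter (fun i => g i ≠ c (y j))).card}).measurableSet
  have hpanel : ∀ A ∈ Finset.powersetCard m (Finset.univ : Finset (Fin n)),
      P.real {ω | M j ω = A ∧ A.card ≤ 2 * (A.filter (fun i => w i (y j) ω ≠ c (y j))).card} ≤
        1 / (n.choose m : ℝ) * ∏ i ∈ A, signMGF γ (η i) := by
    intro A hA
    have hproj : Measurable fun F : Fin s → Finset (Fin n) => F j := measurable_pi_apply j
    have hS : MeasurableSet {F : Fin s → Finset (Fin n) | F j = A} :=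
      hproj (measurableSet_singleton A)
    have h1 := hM.indep.measure_inter_preimage_eq_mul {F | F j = A} (W A) hS (hWmeas A)
    have h2 : P.real {ω | M j ω = A ∧
        A.card ≤ 2 * (A.filter (fun i => w i (y j) ω ≠ c (y j))).card} =
        P.real {ω | M j ω = A} *
          P.real {ω | A.card ≤ 2 * (A.filter (fun i => w i (y j) ω ≠ c (y j))).card} := by
      rw [measureReal_def, measureReal_def, measureReal_def, ← ENNReal.toReal_mul]
      exact congrArg ENNReal.toReal h1
    rw [h2, hM.uniform j A (Finset.mem_powersetCard.mp hA).2]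
    have := measure_panel_wrong_le hw (y j) A (γ := γ) (by linarith)
    gcongr
  have hsub : {ω | votedLabel w M y j ω ≠ c (y j)} ⊆
      ⋃ A ∈ Finset.powersetCard m (Finset.univ : Finset (Fin n)),
        {ω | M j ω = A ∧ A.card ≤ 2 * (A.filter (fun i => w i (y j) ω ≠ c (y j))).card} := by
    intro ω hω
    simp only [Set.mem_iUnion]
    exact ⟨M j ω, Finset.mem_powersetCard.mpr ⟨Finset.subset_univ _, hM.card_panel j ω⟩, rfl,
      card_le_of_majorityVote_ne hω⟩
  have hchoose : (0 : ℝ) < n.choose m := by exact_mod_cast Nat.choose_pos hm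
  have hsign : ∀ i, 0 ≤ signMGF γ (η i) := by
    intro i
    have h1 := (hη i).1
    have h2 : 0 ≤ 1 - η i := by linarith [(hη i).2]
    unfold signMGF
    positivity
  -- `signMGF γ` is affine in the error rate, so its mean over the crowd is its value at the average
  -- rate.
  have hmean : (∑ i, signMGF γ (η i)) / n = signMGF γ e := by
    simp only [signMGF]
    rw [Finset.sum_add_distrib, ← Finset.sum_mul, ← Finset.sum_mul, Finset.sum_sub_distrib,
      ← he']
    simp only [Finset.sum_const, Finset.card_univ, Fintype.card_fin, nsmul_eq_mul, mul_one]
    field_simp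
  have hmac := elemSymm_le_choose_mul_pow hsign (m := m) (by rwa [Fintype.card_fin])
  rw [Fintype.card_fin, hmean] at hmac
  calc P.real {ω | votedLabel w M y j ω ≠ c (y j)}
      ≤ ∑ A ∈ Finset.powersetCard m (Finset.univ : Finset (Fin n)),
          P.real {ω | M j ω = A ∧
            A.card ≤ 2 * (A.filter (fun i => w i (y j) ω ≠ c (y j))).card} :=
        (measureReal_mono hsub (measure_ne_top _ _)).trans (measureReal_biUnion_finset_le _ _)
    _ ≤ ∑ A ∈ Finset.powersetCard m (Finset.univ : Finset (Fin n)),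
          1 / (n.choose m : ℝ) * ∏ i ∈ A, signMGF γ (η i) := Finset.sum_le_sum hpanel
    _ = 1 / (n.choose m : ℝ) * elemSymm (fun i => signMGF γ (η i)) m := by
        rw [← Finset.mul_sum, elemSymm]
    _ ≤ 1 / (n.choose m : ℝ) * (n.choose m * signMGF γ e ^ m) := by gcongr
    _ = signMGF γ e ^ m := by field_simp
    _ ≤ Real.exp (-(γ ^ 2 / 4)) ^ m := by
        have h0 : 0 ≤ signMGF γ e := by
          have : 0 ≤ 1 - e := by linarith
          unfold signMGF
          positivity
        have := signMGF_le he0 havg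
        gcongr
    _ = Real.exp (-(m * γ ^ 2 / 4)) := by
        rw [← Real.exp_nat_mul]
        congr 1
        ring

end Vote

/-! ### The number of tasks -/

lemma votingTasks_eq {Ω : Type*} {n s m : ℕ} {M : Fin s → Ω → Finset (Fin n)}
    (hM : ∀ j ω, (M j ω).card = m) (ω : Ω) : votingTasks M ω = s * m := by
  simp [votingTasks, hM]

/-- Both ceilings are taken of numbers at least 1 and cost a factor 2 each: `10^9 = 50 * (2 *
10^7)`. -/
lemma budget_bounds {n K q s : ℕ} {Δ L : ℝ} (hn : 0 < n) (hΔ : 0 < Δ) (hΔ' : Δ ≤ 1 / 2)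
    (hL : 0 ≤ L) (hq : q = ⌈(10 ^ 7 : ℝ) * ((n : ℝ) / Δ ^ 2 * (1 + L / (K : ℝ)))⌉₊)
    (hs : s = ⌈(25 : ℝ) * ((q : ℝ) / (n : ℝ) ^ (0.3 : ℝ))⌉₊) :
    (4 : ℝ) ≤ s ∧ (s : ℝ) ≤ 10 ^ 9 * ((n : ℝ) ^ (0.7 : ℝ) * (1 + L / K) / Δ ^ 2) := by
  have hn1 : (1 : ℝ) ≤ n := by exact_mod_cast hn
  have hn0 : (0 : ℝ) < n := by linarith
  have hLK : 0 ≤ L / K := by positivity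
  have hΔ2 : Δ ^ 2 ≤ 1 := by nlinarith
  set u : ℝ := (n : ℝ) / Δ ^ 2 * (1 + L / (K : ℝ)) with hu
  have hnu : (n : ℝ) ≤ u := by
    have h1 : (n : ℝ) ≤ n / Δ ^ 2 := by
      rw [le_div_iff₀ (by positivity)]
      nlinarith
    calc (n : ℝ) ≤ n / Δ ^ 2 * 1 := by linarith
      _ ≤ u := by rw [hu]; gcongr; linarith
  have hq1 : 10 ^ 7 * u ≤ q := by rw [hq]; exact Nat.le_ceil _
  have hq2 : (q : ℝ) ≤ 2 * 10 ^ 7 * u := by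
    have := (Nat.ceil_lt_add_one (by linarith : 0 ≤ 10 ^ 7 * u)).le
    rw [← hq] at this
    linarith
  have hpow : (0 : ℝ) < (n : ℝ) ^ (0.3 : ℝ) := by positivity
  have hpow1 : (n : ℝ) ^ (0.3 : ℝ) ≤ n := by
    calc (n : ℝ) ^ (0.3 : ℝ) ≤ (n : ℝ) ^ (1 : ℝ) :=
          Real.rpow_le_rpow_of_exponent_le hn1 (by norm_num)
      _ = n := Real.rpow_one _
  have hr : 1 ≤ (q : ℝ) / (n : ℝ) ^ (0.3 : ℝ) := by
    rw [le_div_iff₀ hpow]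
    linarith
  have hs1 : 25 * ((q : ℝ) / (n : ℝ) ^ (0.3 : ℝ)) ≤ s := by rw [hs]; exact Nat.le_ceil _
  have hs2 : (s : ℝ) ≤ 50 * ((q : ℝ) / (n : ℝ) ^ (0.3 : ℝ)) := by
    have := (Nat.ceil_lt_add_one (by linarith : 0 ≤ 25 * ((q : ℝ) / (n : ℝ) ^ (0.3 : ℝ)))).le
    rw [← hs] at this
    linarith
  refine ⟨by linarith, hs2.trans ?_⟩
  have hn7 : (n : ℝ) / (n : ℝ) ^ (0.3 : ℝ) = (n : ℝ) ^ (0.7 : ℝ) := by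
    rw [div_eq_iff hpow.ne', ← Real.rpow_add hn0]
    norm_num
  calc 50 * ((q : ℝ) / (n : ℝ) ^ (0.3 : ℝ)) ≤ 50 * (2 * 10 ^ 7 * u / (n : ℝ) ^ (0.3 : ℝ)) := by
        gcongr
    _ = 10 ^ 9 * ((n : ℝ) / (n : ℝ) ^ (0.3 : ℝ) * (1 + L / K) / Δ ^ 2) := by
        rw [hu]
        ring
    _ = _ := by rw [hn7]

/-- Up to constants, `s * m` is `B * log s + f` with `f = B * L`. Since `L ≥ L₀ > 0`, `B` is at most
`f / L₀` and `log s` is of order `log (2 + f)`; for `δ` near 1 this would fail, as `f` tends to 0.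
-/
lemma tasks_le {n K s m : ℕ} {Δ δ e L₀ : ℝ} (hL₀ : 0 < L₀) (hδ : 0 < δ)
    (hL : L₀ ≤ Real.log (1 / δ)) (he0 : 0 ≤ e) (he : e < 1 / 2) (hs4 : (4 : ℝ) ≤ s)
    (hs : (s : ℝ) ≤ 10 ^ 9 * ((n : ℝ) ^ (0.7 : ℝ) * (1 + Real.log (1 / δ) / K) / Δ ^ 2))
    (hm : m = ⌈(8 : ℝ) * (Real.log ((s : ℝ) / δ) / (1 - 2 * e) ^ 2)⌉₊) :
    (s : ℝ) * m ≤ 9 * 10 ^ 9 * ((2 * Real.log (10 ^ 9 / L₀ + 1) + 1) / L₀ + 2) *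
      taskBound n K Δ δ e * Real.log (2 + taskBound n K Δ δ e) := by
  set L := Real.log (1 / δ) with hLdef
  set v : ℝ := (n : ℝ) ^ (0.7 : ℝ) * (1 + L / K) / Δ ^ 2 with hv
  set γ := 1 - 2 * e with hγ
  have hγ0 : 0 < γ := by linarith
  have hγ2 : γ ^ 2 ≤ 1 := by nlinarith
  set f := taskBound n K Δ δ e with hf
  set B := v / γ ^ 2 with hB
  have hL0 : 0 < L := hL₀.trans_le hL
  have hv0 : 0 ≤ v := by positivity
  have hvB : v ≤ B := by
    rw [hB, le_div_iff₀ (by positivity)]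
    nlinarith
  have hB0 : 0 ≤ B := hv0.trans hvB
  have hfB : f = B * L := by
    rw [hf, taskBound, hB, hv, ← hLdef, ← hγ]
    field_simp
  have hBf : B ≤ f / L₀ := by
    rw [le_div_iff₀ hL₀, hfB]
    gcongr
  have hf0 : 0 ≤ f := by rw [hfB]; positivity
  have hs0 : (0 : ℝ) < s := by linarith
  have hlogsδ : Real.log ((s : ℝ) / δ) = Real.log s + L := by
    rw [hLdef, one_div, Real.log_inv, Real.log_div hs0.ne' hδ.ne']
    ring
  have hlogs : 1 ≤ Real.log s := by
    rw [Real.le_log_iff_exp_le hs0]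
    linarith [Real.exp_one_lt_d9]
  have hm2 : (m : ℝ) ≤ 9 * ((Real.log s + L) / γ ^ 2) := by
    have h1 : 1 ≤ (Real.log s + L) / γ ^ 2 := by
      rw [le_div_iff₀ (by positivity)]
      linarith
    have h2 := (Nat.ceil_lt_add_one (by rw [hlogsδ]; linarith :
      0 ≤ 8 * (Real.log ((s : ℝ) / δ) / γ ^ 2))).le
    rw [← hm, hlogsδ] at h2
    linarith
  set l := Real.log (2 + f) with hl
  have hl2 : 1 / 2 ≤ l := by
    have h1 : Real.log 2 ≤ l := Real.log_le_log (by norm_num) (by linarith)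
    linarith [Real.log_two_gt_d9]
  set D : ℝ := 10 ^ 9 / L₀ + 1 with hD
  have hD0 : 0 ≤ 10 ^ 9 / L₀ := by positivity
  have hlogD : 0 ≤ Real.log D := Real.log_nonneg (by linarith)
  have hsD : (s : ℝ) ≤ D * (2 + f) := by
    calc (s : ℝ) ≤ 10 ^ 9 * B := hs.trans (by gcongr)
      _ ≤ 10 ^ 9 * (f / L₀) := by gcongr
      _ = 10 ^ 9 / L₀ * f := by ring
      _ ≤ D * (2 + f) := by gcongr <;> linarith
  have hlogs2 : Real.log s ≤ (2 * Real.log D + 1) * l := by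
    calc Real.log s ≤ Real.log (D * (2 + f)) := Real.log_le_log hs0 hsD
      _ = Real.log D + l := Real.log_mul (by linarith) (by linarith)
      _ ≤ _ := by nlinarith
  calc (s : ℝ) * m ≤ (10 ^ 9 * v) * (9 * ((Real.log s + L) / γ ^ 2)) := by gcongr
    _ = 9 * 10 ^ 9 * (B * Real.log s + B * L) := by
        rw [hB]
        ring
    _ ≤ 9 * 10 ^ 9 * (f / L₀ * ((2 * Real.log D + 1) * l) + f * (2 * l)) := by
        have h1 : B * L ≤ f * (2 * l) := by
          rw [← hfB]
          nlinarith
        gcongr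
    _ = _ := by ring

lemma sum_vote_failures_le {s m : ℕ} {δ γ : ℝ} (hδ : 0 < δ) (hδ1 : δ ≤ 1) (hγ : 0 < γ)
    (hs : (4 : ℝ) ≤ s) (hm : 8 * (Real.log ((s : ℝ) / δ) / γ ^ 2) ≤ m) :
    (s : ℝ) * Real.exp (-(m * γ ^ 2 / 4)) ≤ δ / 2 := by
  have hs0 : (0 : ℝ) < s := by linarith
  have h1 : 2 * Real.log ((s : ℝ) / δ) ≤ m * γ ^ 2 / 4 := by
    rw [← mul_div_assoc, div_le_iff₀ (by positivity)] at hm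
    linarith
  have h2 : Real.exp (-(m * γ ^ 2 / 4)) ≤ (δ / s) ^ 2 := by
    -- The factor 8 in `m` makes each failure probability `(δ/s)^2`; one power of `s` pays for the
    -- union over the points.
    calc Real.exp (-(m * γ ^ 2 / 4)) ≤ Real.exp (((2 : ℕ) : ℝ) * Real.log (δ / s)) := by
          apply Real.exp_le_exp.mpr
          rw [← inv_div, Real.log_inv] at h1
          push_cast
          linarith
      _ = (δ / s) ^ 2 := by rw [Real.exp_nat_mul, Real.exp_log (by positivity)]
  calc (s : ℝ) * Real.exp (-(m * γ ^ 2 / 4)) ≤ s * (δ / s) ^ 2 := by gcongr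
    _ = δ * (δ / s) := by field_simp
    _ ≤ δ * (1 / 4) := by gcongr
    _ ≤ δ / 2 := by linarith

/-! ### The algorithm on voted labels -/

section Final

variable {Ω X : Type*} {n s : ℕ} {w : Fin n → X → Ω → Bool} {M : Fin s → Ω → Finset (Fin n)}
  {y : Fin s → X} {c : X → Bool}

lemma votedReward_nonneg (ω : Ω) (i : Fin n) (j : ℕ) : 0 ≤ votedReward w M y ω i j := by
  unfold votedReward
  split_ifs <;> norm_num

lemma votedReward_eq_rewardTable {ω : Ω} (h : ∀ j, votedLabel w M y j ω = c (y j)) :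
    votedReward w M y ω = rewardTable fun p => decide (w p.1 (y p.2) ω = c (y p.2)) := by
  funext i j
  simp only [votedReward, rewardTable, h, decide_eq_true_eq]

lemma pulls_optMAI_le {K q : ℕ} (hK : K ≤ n) {R : Fin n → ℕ → ℝ} (hR : ∀ i j, 0 ≤ R i j)
    (hs : 25 * (q / (n : ℝ) ^ (0.3 : ℝ)) ≤ s) : (optMAI K q R).pulls ≤ s := by
  obtain ⟨l, h1, h2⟩ := exists_pulls_stateAt (q := q) hK hR n
  have h3 : (optMAI K q R).pulls = pullCount n q l := h1
  rw [h3]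
  exact_mod_cast (pullCount_le h2).trans hs

lemma measure_voted_success_ge [MeasurableSpace Ω] {P : Measure Ω} [IsProbabilityMeasure P]
    {η : Fin n → ℝ} {K q m : ℕ} {Δ δ : ℝ} (hw : IsNoisyCrowd P c η w) (hM : IsRandomPanels P m w M)
    (hy : Function.Injective y) (hK : 1 ≤ K) (hKn : K ≤ n) (hΔ : 0 < Δ) (hΔ' : Δ ≤ 1 / 2)
    (hδ : 0 < δ) (hδ' : δ ≤ 1) (hη : ∀ i, 0 ≤ η i ∧ η i ≤ 1 / 2)
    (havg : avgError η Finset.univ < 1 / 2)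
    (hq : 10 ^ 7 * (n / Δ ^ 2 * (1 + Real.log (1 / δ) / K)) ≤ q)
    (hs : 25 * (q / (n : ℝ) ^ (0.3 : ℝ)) ≤ s) (hs4 : (4 : ℝ) ≤ s)
    (hm : 8 * (Real.log ((s : ℝ) / δ) / (1 - 2 * avgError η Finset.univ) ^ 2) ≤ m) (hmn : m ≤ n) :
    1 - δ ≤ P.real {ω | (∀ j, votedLabel w M y j ω = c (y j)) ∧
      IsDeltaOptimal η K Δ (optMAI K q (votedReward w M y ω)).accepted} := by
  let b : Fin n × Fin s → Ω → Bool := fun p ω => decide (w p.1 (y p.2) ω = c (y p.2))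
  have hbm : ∀ p, Measurable (b p) := fun p =>
    (measurable_of_finite fun l : Bool => decide (l = c (y p.2))).comp (hw.measurable_label _ _)
  have hinj : Function.Injective fun p : Fin n × Fin s => (p.1, y p.2) := by
    rintro ⟨i, j⟩ ⟨i', j'⟩ h
    obtain ⟨h1, h2⟩ := Prod.mk.inj h
    exact Prod.ext h1 (hy h2)
  have hbind : iIndepFun b P := (hw.indep.precomp hinj).comp
    (fun p (l : Bool) => decide (l = c (y p.2))) fun _ => measurable_of_finite _
  have hbη : ∀ p, P.real {ω | b p ω = false} = η p.1 := by
    intro p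
    simp only [b, decide_eq_false_iff_not]
    exact hw.error p.1 (y p.2)
  have hopt := measure_not_isDeltaOptimal_le hbm hbind hbη hK hKn hΔ hΔ' hδ hδ' hq hs
  have hvote : P.real (⋃ j ∈ (Finset.univ : Finset (Fin s)), {ω | votedLabel w M y j ω ≠ c (y j)}) ≤
      δ / 2 := by
    refine (measureReal_biUnion_finset_le _ _).trans ?_
    refine (Finset.sum_le_sum fun j _ =>
      measure_votedLabel_ne_le hw hM y j (by omega) hmn hη havg.le).trans ?_
    rw [Finset.sum_const, Finset.card_univ, Fintype.card_fin, nsmul_eq_mul]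
    exact sum_vote_failures_le hδ hδ' (by linarith) hs4 hm
  set good : Set Ω := {ω | (∀ j, votedLabel w M y j ω = c (y j)) ∧
      IsDeltaOptimal η K Δ (optMAI K q (votedReward w M y ω)).accepted}
  have hcover : (Set.univ : Set Ω) ⊆ good ∪
      ((⋃ j ∈ (Finset.univ : Finset (Fin s)), {ω | votedLabel w M y j ω ≠ c (y j)}) ∪
        {ω | ¬ IsDeltaOptimal η K Δ (optMAI K q (rewardTable fun p => b p ω)).accepted}) := by
    intro ω _
    by_cases h1 : ∀ j, votedLabel w M y j ω = c (y j)
    · by_cases h2 : IsDeltaOptimal η K Δ (optMAI K q (rewardTable fun p => b p ω)).accepted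
      · left
        exact ⟨h1, by rw [votedReward_eq_rewardTable h1]; exact h2⟩
      · exact Or.inr (Or.inr h2)
    · push Not at h1
      obtain ⟨j, hj⟩ := h1
      right
      left
      simp only [Set.mem_iUnion]
      exact ⟨j, Finset.mem_univ _, hj⟩
  have h1 : (1 : ℝ) ≤ P.real good + (δ / 2 + δ / 2) := by
    calc (1 : ℝ) = P.real Set.univ := probReal_univ.symm
      _ ≤ _ := measureReal_mono hcover (measure_ne_top _ _)
      _ ≤ _ := measureReal_union_le _ _
      _ ≤ _ := by
        gcongr
        exact (measureReal_union_le _ _).trans (add_le_add hvote hopt)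
  linarith

end Final

theorem corollary2 :
    ∃ Cq > (0 : ℝ), ∃ Cs > (0 : ℝ), ∃ Cm > (0 : ℝ), ∀ δ₀ < (1 : ℝ), ∃ C > (0 : ℝ), ∃ k : ℕ,
      ∀ (n K : ℕ) (Δ δ : ℝ) (η : Fin n → ℝ),
        1 ≤ K → 2 * K ≤ n → 0 < Δ → Δ ≤ 1 / 2 → 0 < δ → δ ≤ δ₀ →
        (∀ i, 0 ≤ η i ∧ η i ≤ 1 / 2) → avgError η Finset.univ < 1 / 2 →
      ∀ q s m : ℕ,
        q = ⌈Cq * ((n : ℝ) / Δ ^ 2 * (1 + Real.log (1 / δ) / (K : ℝ)))⌉₊ →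
        s = ⌈Cs * ((q : ℝ) / (n : ℝ) ^ (0.3 : ℝ))⌉₊ →
        m = ⌈Cm * (Real.log ((s : ℝ) / δ) / (1 - 2 * avgError η Finset.univ) ^ 2)⌉₊ →
        m ≤ n →
      ∀ (Ω X : Type*) [MeasurableSpace Ω] (P : Measure Ω) [IsProbabilityMeasure P]
        (c : X → Bool) (w : Fin n → X → Ω → Bool) (M : Fin s → Ω → Finset (Fin n)) (y : Fin s → X),
        IsNoisyCrowd P c η w → IsRandomPanels P m w M → Function.Injective y →
        (∀ ω, (votingTasks M ω : ℝ) ≤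
          C * taskBound n K Δ δ (avgError η Finset.univ) *
            Real.log (2 + taskBound n K Δ δ (avgError η Finset.univ)) ^ k) ∧
        (∀ ω, (optMAI K q (votedReward w M y ω)).pulls ≤ s) ∧
        1 - δ ≤ P.real {ω | (∀ j, votedLabel w M y j ω = c (y j)) ∧
          IsDeltaOptimal η K Δ (optMAI K q (votedReward w M y ω)).accepted} := by
  -- `10^7` comes from `le_roundPulls_mul_sq`, `25` from `pullCount_le`, and `8` from
  -- `sum_vote_failures_le`.
  refine ⟨10 ^ 7, by norm_num, 25, by norm_num, 8, by norm_num, fun δ₀ hδ₀ => ?_⟩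
  rcases le_or_gt δ₀ 0 with hneg | hδ₀0
  · refine ⟨1, one_pos, 0, ?_⟩
    intro n K Δ δ η _ _ _ _ hδ hδ'
    linarith
  have hL₀ : 0 < Real.log (1 / δ₀) := Real.log_pos (by rw [lt_div_iff₀ hδ₀0]; linarith)
  have hlogD : 0 ≤ Real.log (10 ^ 9 / Real.log (1 / δ₀) + 1) :=
    Real.log_nonneg (by linarith [show 0 ≤ 10 ^ 9 / Real.log (1 / δ₀) by positivity])
  refine ⟨9 * 10 ^ 9 * ((2 * Real.log (10 ^ 9 / Real.log (1 / δ₀) + 1) + 1) / Real.log (1 / δ₀) + 2),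
    by positivity, 1, ?_⟩
  intro n K Δ δ η hK hKn hΔ hΔ' hδ hδ' hη havg q s m hq hs hm hmn Ω X _ P _ c w M y hw hM hy
  have hL : Real.log (1 / δ₀) ≤ Real.log (1 / δ) := Real.log_le_log (by positivity) (by gcongr)
  have hn : 0 < n := by omega
  obtain ⟨hs4, hs9⟩ := budget_bounds hn hΔ hΔ' (hL₀.le.trans hL) hq hs
  have hq' : 10 ^ 7 * ((n : ℝ) / Δ ^ 2 * (1 + Real.log (1 / δ) / K)) ≤ q := by
    rw [hq]
    exact Nat.le_ceil _
  have hs' : 25 * ((q : ℝ) / (n : ℝ) ^ (0.3 : ℝ)) ≤ s := by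
    rw [hs]
    exact Nat.le_ceil _
  have hm' : 8 * (Real.log ((s : ℝ) / δ) / (1 - 2 * avgError η Finset.univ) ^ 2) ≤ m := by
    rw [hm]
    exact Nat.le_ceil _
  have he0 : 0 ≤ avgError η Finset.univ :=
    div_nonneg (Finset.sum_nonneg fun i _ => (hη i).1) (Nat.cast_nonneg _)
  refine ⟨fun ω => ?_, fun ω => pulls_optMAI_le (by omega) (votedReward_nonneg ω) hs', ?_⟩
  · rw [votingTasks_eq hM.card_panel ω, pow_one]
    push_cast
    exact tasks_le hL₀ hδ hL he0 havg hs4 hs9 hm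
  · exact measure_voted_success_ge hw hM hy hK (by omega) hΔ hΔ' hδ (by linarith) hη havg hq' hs' hs4
      hm' hmn
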